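/- For a complex-valued integrable function $g$ on $[0,1]$ and an interval $J\subset[0,1]$ let $$(\mathcal{E}_J g)(x)=\int_J g(\xi)\,e^{2\pi i(\xi x_1+\xi^2x_2)}\,d\xi,\qquad x=(x_1,x_2)\in\mathbb{R}^2.$$ For a square $B\subset\mathbb{R}^2$ with sides parallel to the axes, centre $c$ and side length $R$, let $w_B(x)=(1+|x-c|/R)^{-100}$, where $|\cdot|$ is the Euclidean norm, and put $$\|f\|_{L^6(B)}=\Big(\int_B|f|^6\Big)^{1/6},\qquad \|f\|_{L^6(w_B)}=\Big(\int_{\mathbb{R}^2}|f|^6w_B\Big)^{1/6}.$$ For $\delta\in\mathbb{N}^{-1}=\{1/N : N=1,2,3,\dots\}$ let $P_\delta([0,1])$ be the partition of $[0,1]$ into $\delta^{-1}$ intervals of length $\delta$, and let $D(\delta)$ be the best (smallest) constant such that $$\|\mathcal{E}_{[0,1]}g\|_{L^6(B)}\le D(\delta)\Big(\sum_{J\in P_\delta([0,1])}\|\mathcal{E}_Jg\|_{L^6(w_B)}^2\Big)^{1/2}$$ for all such $g$ and all squares $B$ (with sides parallel to the axes) of side length $\delta^{-2}$. **Theorem.**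 For every $\delta\in\mathbb{N}^{-1}$ with $0<\delta<e^{-200^{200}}$, $$D(\delta)\le\exp\Big(30\,\frac{\log\frac1\delta}{\log\log\frac1\delta}\Big).$$ -/

import Mathlib

open MeasureTheory Set
open scoped ENNReal

noncomputable section

namespace ParabolaDecoupling

/-- The Euclidean plane `ℝ²`, with the Euclidean norm and Lebesgue measure. -/
abbrev Plane : Type := EuclideanSpace ℝ (Fin 2)

/-- `e(a) = exp(2πia)`. -/
def e (a : ℝ) : ℂ := Complex.exp (2 * (Real.pi : ℂ) * Complex.I * (a : ℂ))

/-- The extension operator of the parabola over `J`: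
`(E_J g)(x) = ∫_J g(ξ) e(ξ x₁ + ξ² x₂) dξ`. -/
def extension (J : Set ℝ) (g : ℝ → ℂ) (x : Plane) : ℂ :=
  ∫ ξ in J, g ξ * e (ξ * x 0 + ξ ^ 2 * x 1)

/-- The axis-parallel square with centre `c` and side length `R`. -/
def square (c : Plane) (R : ℝ) : Set Plane :=
  {x | ∀ i, |x i - c i| ≤ R / 2}

/-- The weight `w_B(x) = (1 + |x - c| / R)^(-100)` of the square `B` with centre `c` and side
length `R`, where `|x - c|` is the Euclidean distance. -/
def weight (c : Plane) (R : ℝ) (x : Plane) : ℝ :=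
  ((1 + ‖x - c‖ / R) ^ 100)⁻¹

/-- `‖f‖_{L⁶(B)}`. -/
def normL6On (B : Set Plane) (f : Plane → ℂ) : ℝ≥0∞ :=
  eLpNorm f 6 (volume.restrict B)

/-- `‖f‖_{L⁶(w)} = (∫ |f|⁶ w)^(1/6)`. -/
def normL6Weighted (w : Plane → ℝ) (f : Plane → ℂ) : ℝ≥0∞ :=
  eLpNorm f 6 (volume.withDensity fun x => ENNReal.ofReal (w x))

/-- The `k`-th interval of length `δ`, `[kδ, (k+1)δ]`. When `1/δ = N` is a positive integer, the
ones with `k < N` form the partition `P_δ([0, 1])` (up to endpoints). -/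
def cap (δ : ℝ) (k : ℕ) : Set ℝ := Icc (k * δ) ((k + 1) * δ)

/-- `C` is admissible at scale `δ` (the reciprocal of a positive integer) if
`‖E_{[0,1]} g‖_{L⁶(B)} ≤ C (∑_{J ∈ P_δ([0,1])} ‖E_J g‖_{L⁶(w_B)}²)^(1/2)`
for all integrable `g` on `[0, 1]` and all squares `B` of side length `δ⁻²`. -/
def IsAdmissible (δ : ℝ) (C : ℝ≥0∞) : Prop :=
  ∀ g : ℝ → ℂ, IntegrableOn g (Icc 0 1) → ∀ c : Plane,
    normL6On (square c ((δ ^ 2)⁻¹)) (extension (Icc 0 1) g) ≤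
      C * (∑ k ∈ Finset.range ⌊δ⁻¹⌋₊,
        normL6Weighted (weight c ((δ ^ 2)⁻¹)) (extension (cap δ k) g) ^ 2) ^ (1 / 2 : ℝ)

/-- The `ℓ²L⁶` decoupling constant `D(δ)` of the parabola: the best constant in the decoupling
inequality at scale `δ`, with value `∞` if no finite constant is admissible. -/
def decouplingConstant (δ : ℝ) : ℝ≥0∞ := sInf {C | IsAdmissible δ C}

end ParabolaDecoupling

end

/-!
The decoupling inequality is first proved on the whole plane, for functions `f k` whose spectrum
lies in the `4δ²`-neighbourhoods of consecutive arcs of length `δ` of the parabola, with `n ^ m`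
arcs in total (`DecouplingBound`). Since the statement is quantified over all scales `δ` and all
positions of the arcs, every sub-arc is again an instance of it with a smaller `m`; this replaces
parabolic rescaling.

Let `E m` be the sixth power of the decoupling constant. The broad-narrow dichotomy at scale `1 / n`
(`DecouplingBound.of_bilinearBound`) gives `E m ≤ 4 ^ 6 * E (m - 1) + n ^ 8 * X`, where `X` is the
constant in the bilinear inequality for `∫ |f|² |g|⁴`, with `f` and `g` on arcs separated by `1 / n`
of the total length (`BilinearBound`). Two moves are iterated on the bilinear inequality:

* If `g` lives on an arc of relative length `n ^ (-b)`, then `|g|⁴` is harmless for orthogonality in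
  the direction normal to that arc, at frequencies above the width `n ^ (-2b)` of its neighbourhood.
  The arc of `f` is transverse to that direction, so `f` may be cut into pieces of length
  `n ^ (-2b)`, by Plancherel, at the cost of a factor `36 n` (`BilinearBound.of_shorter`).
* Cauchy-Schwarz in the form `|f|² |g|⁴ = (|f|² |g|) |g|³` exchanges the roles of `f` and `g` and
  splits off the factor `E (m - b) ^ (1 / 2)` (`BilinearBound.swap`).

Each round doubles `b` and halves the exponent of what is left, so `j` rounds save a factor
`q ^ (j / 2)` against a growth rate `E m ≈ q ^ m`, while the total loss is a fixed power of `n`. Hence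
`q` may be taken as a power of `n` with exponent of order `1 / j` (`decouplingBound_of_iterate`).

The extension operator on a square of side `δ⁻²` reduces to this by multiplying `E_J g` with a
window whose Fourier transform is supported in a square of half side `δ²`
(`isAdmissible_of_decouplingBound`). With `N = 1 / δ` arcs and `n ^ m ≥ N`, taking `j` of order
`log log N` and `log n` a positive power of `log N` gives the bound (`exists_parameters`).
-/

noncomputable section

namespace ParabolaDecoupling

open scoped FourierTransform Convolution


/-! ### Plancherel and functions with prescribed spectrum -/

section Plancherel

variable {V : Type*} [NormedAddCommGroup V] [InnerProductSpace ℝ V] [FiniteDimensional ℝ V]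
  [MeasurableSpace V] [BorelSpace V]

open scoped ContDiff in
/-- The abstract Fourier transform on `L²`, defined by density, is given by the Fourier integral
on `L¹ ∩ L²`: both define the same tempered distribution. -/
theorem coeFn_fourier_toLp_ae_eq {F : V → ℂ} (h1 : Integrable F) (h2 : MemLp F 2) :
    ((𝓕 (h2.toLp F) : Lp ℂ 2 (volume : Measure V)) : V → ℂ) =ᵐ[volume] 𝓕 F := by
  apply ae_eq_of_integral_contDiff_smul_eq
  · exact (Lp.memLp _).locallyIntegrable (by norm_num)
  · have hc : Continuous (𝓕 F) :=
      VectorFourier.fourierIntegral_continuous Real.continuous_fourierChar continuous_inner h1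
    exact hc.locallyIntegrable
  · intro g g_smooth g_cpt
    have hg₁ : HasCompactSupport (Complex.ofRealCLM ∘ g) := g_cpt.comp_left rfl
    have hg₂ : ContDiff ℝ ∞ (Complex.ofRealCLM ∘ g) := by fun_prop
    set G := hg₁.toSchwartzMap hg₂ with hG
    have hGint : Integrable (G : V → ℂ) := G.integrable
    have e1 : ∫ x, g x • ((𝓕 (h2.toLp F) : Lp ℂ 2 (volume : Measure V)) : V → ℂ) x
        = (Lp.toTemperedDistribution (𝓕 (h2.toLp F) : Lp ℂ 2 (volume : Measure V))) G := by
      simp [hG]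
    have e2 : ∫ x, g x • 𝓕 F x = ∫ x, 𝓕 F x • G x := by
      simp [hG, mul_comm]
    rw [e1, e2, ← Lp.fourier_toTemperedDistribution_eq, TemperedDistribution.fourier_apply,
      Lp.toTemperedDistribution_apply]
    have := VectorFourier.integral_fourierIntegral_smul_eq_flip (L := innerₗ V)
      Real.continuous_fourierChar continuous_inner h1 hGint (μ := volume) (ν := volume)
    rw [flip_innerₗ] at this
    refine Eq.trans ?_ this.symm
    refine integral_congr_ae ?_
    filter_upwards [h2.coeFn_toLp] with x hx
    rw [hx, smul_eq_mul, smul_eq_mul, mul_comm, SchwartzMap.fourier_coe]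
    rfl

theorem lintegral_enorm_fourier_sq {F : V → ℂ} (h1 : Integrable F) (h2 : MemLp F 2) :
    ∫⁻ x, ‖𝓕 F x‖ₑ ^ 2 = ∫⁻ x, ‖F x‖ₑ ^ 2 := by
  have key : eLpNorm (𝓕 F) 2 volume = eLpNorm F 2 volume := by
    rw [← eLpNorm_congr_ae (coeFn_fourier_toLp_ae_eq h1 h2), ← eLpNorm_congr_ae h2.coeFn_toLp]
    have := Lp.norm_fourier_eq (h2.toLp F)
    rw [Lp.norm_def, Lp.norm_def] at this
    exact (ENNReal.toReal_eq_toReal_iff' (Lp.eLpNorm_ne_top _) (Lp.eLpNorm_ne_top _)).1 this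
  rw [eLpNorm_eq_lintegral_rpow_enorm_toReal (by norm_num) (by norm_num),
    eLpNorm_eq_lintegral_rpow_enorm_toReal (by norm_num) (by norm_num)] at key
  have := congrArg (fun t : ℝ≥0∞ => t ^ (2 : ℝ)) key
  simp only [ENNReal.toReal_ofNat, ← ENNReal.rpow_mul] at this
  norm_num at this
  exact this

end Plancherel

/-- `f` is a superposition `∫ F(ζ) e(-x·ζ) dζ` with `F` integrable and bounded, and all its
frequencies lie in `Ω`. Frequencies are measured with respect to `e(x·ζ)`, as in the definition of
the extension operator, whereas `𝓕` uses `e(-x·ζ)`; hence the sign in the third condition. -/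
def HasSpectrum (Ω : Set Plane) (f : Plane → ℂ) : Prop :=
  ∃ F : Plane → ℂ, Integrable F ∧ (∃ C : ℝ, ∀ ζ, ‖F ζ‖ ≤ C) ∧ (∀ ζ, F ζ ≠ 0 → -ζ ∈ Ω) ∧ f = 𝓕 F

theorem memLp_two_of_integrable_of_bounded {α : Type*} [MeasurableSpace α] {μ : Measure α}
    {F : α → ℂ} (h : Integrable F μ) {C : ℝ} (hC : ∀ ζ, ‖F ζ‖ ≤ C) : MemLp F 2 μ := by
  rw [memLp_two_iff_integrable_sq_norm h.aestronglyMeasurable]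
  refine (h.norm.const_mul C).mono' (h.aestronglyMeasurable.norm.pow 2) (ae_of_all _ fun x => ?_)
  rw [Real.norm_of_nonneg (by positivity), sq]
  exact mul_le_mul_of_nonneg_right (hC x) (norm_nonneg _)

theorem HasSpectrum.continuous {Ω : Set Plane} {f : Plane → ℂ} (h : HasSpectrum Ω f) :
    Continuous f := by
  obtain ⟨F, h1, -, -, rfl⟩ := h
  exact VectorFourier.fourierIntegral_continuous Real.continuous_fourierChar continuous_inner h1

theorem HasSpectrum.mono {Ω Ω' : Set Plane} {f : Plane → ℂ} (h : HasSpectrum Ω f) (hΩ : Ω ⊆ Ω') :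
    HasSpectrum Ω' f := by
  obtain ⟨F, h1, h2, h3, h4⟩ := h
  exact ⟨F, h1, h2, fun ζ hζ => hΩ (h3 ζ hζ), h4⟩

theorem fourier_add_of_integrable {F G : Plane → ℂ} (hF : Integrable F) (hG : Integrable G) :
    𝓕 (F + G) = 𝓕 F + 𝓕 G :=
  VectorFourier.fourierIntegral_add Real.continuous_fourierChar continuous_inner hF hG

theorem fourier_zero_fun : 𝓕 (0 : Plane → ℂ) = 0 := by
  ext x; simp [Real.fourier_eq]

theorem fourier_sum_of_integrable {ι : Type*} (s : Finset ι) {F : ι → Plane → ℂ}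
    (hF : ∀ i ∈ s, Integrable (F i)) : 𝓕 (∑ i ∈ s, F i) = ∑ i ∈ s, 𝓕 (F i) := by
  classical
  induction s using Finset.induction_on with
  | empty => simpa using fourier_zero_fun
  | insert i s hi ih =>
    rw [Finset.sum_insert hi, Finset.sum_insert hi, fourier_add_of_integrable
      (hF i (Finset.mem_insert_self i s))
      (integrable_finsetSum' s fun k hk => hF k (Finset.mem_insert_of_mem hk)),
      ih fun k hk => hF k (Finset.mem_insert_of_mem hk)]

theorem hasSpectrum_zero (Ω : Set Plane) : HasSpectrum Ω 0 :=
  ⟨0, integrable_zero _ _ _, ⟨0, by simp⟩, by simp, fourier_zero_fun.symm⟩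

theorem HasSpectrum.add {Ω : Set Plane} {f g : Plane → ℂ} (hf : HasSpectrum Ω f)
    (hg : HasSpectrum Ω g) : HasSpectrum Ω (f + g) := by
  obtain ⟨F, h1, ⟨C, h2⟩, h3, rfl⟩ := hf
  obtain ⟨G, k1, ⟨D, k2⟩, k3, rfl⟩ := hg
  refine ⟨F + G, h1.add k1, ⟨C + D, fun ζ => (norm_add_le _ _).trans (add_le_add (h2 ζ) (k2 ζ))⟩,
    fun ζ hζ => ?_, (fourier_add_of_integrable h1 k1).symm⟩
  by_cases h : F ζ = 0
  · exact k3 ζ fun h' => hζ (by simp [h, h'])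
  · exact h3 ζ h

theorem HasSpectrum.sum {ι : Type*} (s : Finset ι) {Ω : Set Plane} {f : ι → Plane → ℂ}
    (hf : ∀ i ∈ s, HasSpectrum Ω (f i)) : HasSpectrum Ω (∑ i ∈ s, f i) := by
  classical
  induction s using Finset.induction_on with
  | empty => simpa using hasSpectrum_zero Ω
  | insert i s hi ih =>
    rw [Finset.sum_insert hi]
    exact (hf i (Finset.mem_insert_self i s)).add (ih fun k hk => hf k (Finset.mem_insert_of_mem hk))

open scoped Pointwise in
/-- The spectrum of a product lies in the sumset of the spectra. -/
theorem HasSpectrum.mul {Ω Ω' : Set Plane} {f g : Plane → ℂ} (hf : HasSpectrum Ω f)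
    (hg : HasSpectrum Ω' g) : HasSpectrum (Ω + Ω') (f * g) := by
  obtain ⟨F, h1, ⟨C, h2⟩, h3, rfl⟩ := hf
  obtain ⟨G, k1, ⟨D, k2⟩, k3, rfl⟩ := hg
  refine ⟨F ⋆[ContinuousLinearMap.mul ℂ ℂ] G,
    h1.integrable_convolution (ContinuousLinearMap.mul ℂ ℂ) k1, ⟨(∫ t, ‖F t‖) * D, fun ζ => ?_⟩,
    fun ζ hζ => ?_, ?_⟩
  · rw [convolution_def, ← integral_mul_const]
    refine norm_integral_le_of_norm_le (h1.norm.mul_const D) (ae_of_all _ fun t => ?_)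
    simp only [ContinuousLinearMap.mul_apply', norm_mul]
    exact mul_le_mul_of_nonneg_left (k2 _) (norm_nonneg _)
  · obtain ⟨t, ht⟩ : ∃ t, F t * G (ζ - t) ≠ 0 := by
      by_contra! h
      exact hζ (by simp [convolution_def, h])
    refine ⟨-t, h3 t (left_ne_zero_of_mul ht), -(ζ - t), k3 _ (right_ne_zero_of_mul ht), ?_⟩
    change -t + -(ζ - t) = -ζ
    abel
  · ext x
    exact (Real.fourier_mul_convolution_eq h1 k1 x).symm

/-- Almost orthogonality: if the spectra of `f i` and `f j` are disjoint as soon as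
`M ≤ |i - j|`, then at most `M` of the Fourier transforms are nonzero at any given frequency, and
Cauchy-Schwarz together with Plancherel loses only the factor `M`. -/
theorem lintegral_sum_sq_le_of_disjoint_spectra {L M : ℕ} {Ω : ℕ → Set Plane}
    {f : ℕ → Plane → ℂ} (hf : ∀ i < L, HasSpectrum (Ω i) (f i))
    (hΩ : ∀ i < L, ∀ j < L, i + M ≤ j → Disjoint (Ω i) (Ω j)) :
    ∫⁻ x, ‖∑ i ∈ Finset.range L, f i x‖ₑ ^ 2
      ≤ M * ∑ i ∈ Finset.range L, ∫⁻ x, ‖f i x‖ₑ ^ 2 := by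
  classical
  choose! F h1 h2 h3 h4 using hf
  have hL2 : ∀ i < L, MemLp (F i) 2 := fun i hi =>
    memLp_two_of_integrable_of_bounded (h1 i hi) (h2 i hi).choose_spec
  have hsum : ∀ x, ∑ i ∈ Finset.range L, f i x = 𝓕 (∑ i ∈ Finset.range L, F i) x := by
    intro x
    rw [fourier_sum_of_integrable _ fun i hi => h1 i (Finset.mem_range.1 hi), Finset.sum_apply]
    exact Finset.sum_congr rfl fun i hi => by rw [h4 i (Finset.mem_range.1 hi)]
  have hpt : ∀ ζ, ‖(∑ i ∈ Finset.range L, F i) ζ‖ₑ ^ 2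
      ≤ M * ∑ i ∈ Finset.range L, ‖F i ζ‖ₑ ^ 2 := by
    intro ζ
    set s := (Finset.range L).filter fun i => F i ζ ≠ 0 with hs
    have hcard : s.card ≤ M := by
      rcases s.eq_empty_or_nonempty with h | h
      · simp [h]
      have hsub : s ⊆ Finset.Ico (s.min' h) (s.min' h + M) := by
        intro j hj
        have hi := s.min'_mem h
        rw [Finset.mem_Ico]
        refine ⟨s.min'_le j hj, ?_⟩
        by_contra! hlt
        simp only [hs, Finset.mem_filter, Finset.mem_range] at hi hj
        exact Set.disjoint_left.1 (hΩ _ hi.1 _ hj.1 hlt) (h3 _ hi.1 ζ hi.2) (h3 _ hj.1 ζ hj.2)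
      simpa using Finset.card_le_card hsub
    have hreal : ‖(∑ i ∈ Finset.range L, F i) ζ‖ ^ 2
        ≤ M * ∑ i ∈ Finset.range L, ‖F i ζ‖ ^ 2 := by
      have e1 : (∑ i ∈ Finset.range L, F i) ζ = ∑ i ∈ s, F i ζ := by
        rw [Finset.sum_apply, hs, Finset.sum_filter_ne_zero]
      rw [e1]
      calc ‖∑ i ∈ s, F i ζ‖ ^ 2 ≤ (∑ i ∈ s, ‖F i ζ‖) ^ 2 := by
            gcongr; exact norm_sum_le _ _
        _ ≤ s.card * ∑ i ∈ s, ‖F i ζ‖ ^ 2 := sq_sum_le_card_mul_sum_sq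
        _ ≤ M * ∑ i ∈ Finset.range L, ‖F i ζ‖ ^ 2 := by
            gcongr
            exact Finset.filter_subset _ _
    have := ENNReal.ofReal_le_ofReal hreal
    rw [ENNReal.ofReal_mul (by positivity), ENNReal.ofReal_natCast,
      ENNReal.ofReal_sum_of_nonneg fun _ _ => by positivity] at this
    simpa [ENNReal.ofReal_pow, ofReal_norm] using this
  have hFm : ∀ i < L, AEMeasurable (fun ζ => ‖F i ζ‖ₑ ^ 2) := fun i hi =>
    (h1 i hi).aestronglyMeasurable.enorm.pow_const 2
  calc ∫⁻ x, ‖∑ i ∈ Finset.range L, f i x‖ₑ ^ 2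
      = ∫⁻ x, ‖𝓕 (∑ i ∈ Finset.range L, F i) x‖ₑ ^ 2 := by simp_rw [hsum]
    _ = ∫⁻ ζ, ‖(∑ i ∈ Finset.range L, F i) ζ‖ₑ ^ 2 :=
        lintegral_enorm_fourier_sq
          (integrable_finsetSum' _ fun i hi => h1 i (Finset.mem_range.1 hi))
          (memLp_finsetSum' _ fun i hi => hL2 i (Finset.mem_range.1 hi))
    _ ≤ ∫⁻ ζ, M * ∑ i ∈ Finset.range L, ‖F i ζ‖ₑ ^ 2 := lintegral_mono hpt
    _ = M * ∑ i ∈ Finset.range L, ∫⁻ ζ, ‖F i ζ‖ₑ ^ 2 := by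
        rw [lintegral_const_mul' _ _ (ENNReal.natCast_ne_top M),
          lintegral_finsetSum' _ fun i hi => hFm i (Finset.mem_range.1 hi)]
    _ = M * ∑ i ∈ Finset.range L, ∫⁻ x, ‖f i x‖ₑ ^ 2 := by
        congr 1
        refine Finset.sum_congr rfl fun i hi => ?_
        have hi := Finset.mem_range.1 hi
        rw [h4 i hi, lintegral_enorm_fourier_sq (h1 i hi) (hL2 i hi)]

/-! ### Neighbourhoods of arcs of the parabola and transversality -/

/-- The part of the `4δ²`-neighbourhood of the parabola over the `δ`-neighbourhood of
`[a, a + ℓ]`. An affine map preserving the parabola carries such sets to sets of the same kind, and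
all statements about them below are for arbitrary `δ > 0` and `a`. -/
def capNhd (δ a ℓ : ℝ) : Set Plane :=
  {ζ | a - δ ≤ ζ 0 ∧ ζ 0 ≤ a + ℓ + δ ∧ |ζ 1 - ζ 0 ^ 2| ≤ 4 * δ ^ 2}

theorem capNhd_subset {δ a ℓ b ℓ' : ℝ} (h1 : b ≤ a) (h2 : a + ℓ ≤ b + ℓ') :
    capNhd δ a ℓ ⊆ capNhd δ b ℓ' :=
  fun _ h => ⟨by linarith [h.1], by linarith [h.2.1], h.2.2⟩

open scoped Pointwise in
/-- Transversality. Let `N'` be the neighbourhood of an arc over `[a', a' + ℓ₂]`, and consider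
two points at distance at least `s / 2` from `a'`, on the same side. The functional
`(ξ, η) ↦ η - 2a'ξ` varies by `O(ℓ₂²)` on `N'`, but by at least `s |u - v|` between the points of
the parabola over `u` and `v`. -/
theorem disjoint_add_capNhd_of_far {δ s a' ℓ₂ D a b ℓ : ℝ} (hδ : 0 < δ) (hs : 0 < s)
    (hδ2 : δ ≤ ℓ₂) (hD : 32 * ℓ₂ ^ 2 < s * D) (hab : a + ℓ + 2 * δ + D ≤ b)
    (hside : b + ℓ + δ + s / 2 ≤ a' ∨ a' + s / 2 ≤ a - δ) (hℓ : 0 ≤ ℓ) (hD0 : 0 ≤ D) :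
    Disjoint (capNhd δ a ℓ + capNhd δ a' ℓ₂ + capNhd δ a' ℓ₂)
      (capNhd δ b ℓ + capNhd δ a' ℓ₂ + capNhd δ a' ℓ₂) := by
  rw [Set.disjoint_left]
  rintro ζ ⟨_, ⟨z1, h1, z2, h2, rfl⟩, z3, h3, rfl⟩ ⟨_, ⟨w1, k1, w2, k2, rfl⟩, w3, k3, hζ⟩
  have e0 : w1 0 + w2 0 + w3 0 = z1 0 + z2 0 + z3 0 := congrArg (fun z : Plane => z 0) hζ
  have e1 : w1 1 + w2 1 + w3 1 = z1 1 + z2 1 + z3 1 := congrArg (fun z : Plane => z 1) hζ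
  have arc : ∀ z ∈ capNhd δ a' ℓ₂, -(4 * δ ^ 2) ≤ z 1 - 2 * a' * z 0 + a' ^ 2 ∧
      z 1 - 2 * a' * z 0 + a' ^ 2 ≤ 4 * ℓ₂ ^ 2 + 4 * δ ^ 2 := by
    rintro z ⟨g1, g2, g3⟩
    have g4 := abs_le.1 g3
    have g5 : (z 0 - a') ^ 2 ≤ (2 * ℓ₂) ^ 2 := sq_le_sq' (by linarith) (by linarith)
    constructor <;> nlinarith [sq_nonneg (z 0 - a')]
  have a2 := arc _ h2
  have a3 := arc _ h3
  have b2 := arc _ k2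
  have b3 := arc _ k3
  obtain ⟨p1, p2, p3⟩ := h1
  obtain ⟨q1, q2, q3⟩ := k1
  have p4 := abs_le.1 p3
  have q4 := abs_le.1 q3
  have hle : δ ^ 2 ≤ ℓ₂ ^ 2 := by gcongr
  have e2 : a' * w1 0 + a' * w2 0 + a' * w3 0 = a' * z1 0 + a' * z2 0 + a' * z3 0 := by
    rw [← mul_add, ← mul_add, e0]; ring
  have id1 : (w1 0 - z1 0) * (w1 0 + z1 0 - 2 * a')
      = w1 0 ^ 2 - 2 * a' * w1 0 - (z1 0 ^ 2 - 2 * a' * z1 0) := by ring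
  have up : (w1 0 - z1 0) * (w1 0 + z1 0 - 2 * a') ≤ 32 * ℓ₂ ^ 2 := by rw [id1]; linarith
  have low : -(32 * ℓ₂ ^ 2) ≤ (w1 0 - z1 0) * (w1 0 + z1 0 - 2 * a') := by rw [id1]; linarith
  have hd : D ≤ w1 0 - z1 0 := by linarith
  rcases hside with h | h
  · have h1 : s ≤ -(w1 0 + z1 0 - 2 * a') := by linarith
    have h2 := mul_le_mul hd h1 hs.le (hD0.trans hd)
    linarith
  · have h1 : s ≤ w1 0 + z1 0 - 2 * a' := by linarith
    have h2 := mul_le_mul hd h1 hs.le (hD0.trans hd)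
    linarith

/-- Orthogonality in the transverse direction: in the presence of the factor `|G|⁴`, with `G`
supported on an arc of length `ℓ₂` at distance `s`, functions on arcs of length about `ℓ₂² / s` are
almost orthogonal. -/
theorem lintegral_sum_sq_mul_pow_four_le {n L : ℕ} {δ s a a' ℓ₁ ℓ₂ : ℝ} {F : ℕ → Plane → ℂ}
    {G : Plane → ℂ} (hn : 1 ≤ n) (hδ : 0 < δ) (hs : 2 * δ ≤ s) (hδ1 : δ ≤ ℓ₁) (hδ2 : δ ≤ ℓ₂)
    (hℓ : ℓ₂ ^ 2 ≤ n * s * ℓ₁)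
    (hF : ∀ i < L, HasSpectrum (capNhd δ (a + i * ℓ₁) ℓ₁) (F i))
    (hG : HasSpectrum (capNhd δ a' ℓ₂) G)
    (hsep : a + L * ℓ₁ + s ≤ a' ∨ a' + ℓ₂ + s ≤ a) :
    ∫⁻ x, ‖∑ i ∈ Finset.range L, F i x‖ₑ ^ 2 * ‖G x‖ₑ ^ 4
      ≤ (36 * n : ℕ) * ∑ i ∈ Finset.range L, ∫⁻ x, ‖F i x‖ₑ ^ 2 * ‖G x‖ₑ ^ 4 := by
  have hn' : (1 : ℝ) ≤ n := by exact_mod_cast hn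
  have key := lintegral_sum_sq_le_of_disjoint_spectra (L := L) (M := 36 * n)
    (f := fun i => F i * G * G) (fun i hi => ((hF i hi).mul hG).mul hG) ?_
  · convert key using 4 with x i
    · rw [show ∑ i ∈ Finset.range L, (F i * G * G) x = (∑ i ∈ Finset.range L, F i x) * (G x * G x) by
        simp [Finset.sum_mul, mul_assoc], enorm_mul, enorm_mul]
      ring
    · ext x
      rw [Pi.mul_apply, Pi.mul_apply, enorm_mul, enorm_mul]
      ring
  · intro i hi j hj hij
    have hiL : (i : ℝ) + 1 ≤ L := by exact_mod_cast hi
    have hjL : (j : ℝ) + 1 ≤ L := by exact_mod_cast hj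
    have hij' : (i : ℝ) + 36 * n ≤ j := by exact_mod_cast hij
    have hℓ1 : 0 < ℓ₁ := by linarith
    have hsℓ : 0 < s * ℓ₁ := by nlinarith
    have hi0 : (0 : ℝ) ≤ i * ℓ₁ := by positivity
    have hprod : (i : ℝ) * ℓ₁ + 36 * n * ℓ₁ ≤ j * ℓ₁ := by nlinarith
    have hprodL : (j : ℝ) * ℓ₁ + ℓ₁ ≤ L * ℓ₁ := by nlinarith
    have hnl : ℓ₁ ≤ n * ℓ₁ := by nlinarith
    -- Arcs whose indices differ by `36 n` are at distance at least `33 n ℓ₁`: the remaining `3 n ℓ₁`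
    -- absorb the length of an arc and the enlargement by `δ` at both ends.
    refine disjoint_add_capNhd_of_far (s := s) (D := 33 * n * ℓ₁) hδ (by linarith) hδ2 ?_ ?_ ?_ hℓ1.le
      (by positivity)
    · nlinarith
    · nlinarith
    · rcases hsep with h | h
      · left; linarith
      · right; linarith

/-! ### Decoupling inequalities for functions with spectrum near the parabola -/

/-- Functions `f k`, `k < L`, with spectrum near the consecutive arcs over
`[a + kδ, a + (k + 1)δ]`. -/
def IsCapFamily (δ a : ℝ) (L : ℕ) (f : ℕ → Plane → ℂ) : Prop :=
  ∀ k < L, HasSpectrum (capNhd δ (a + k * δ) δ) (f k)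

/-- `‖f‖_{L⁶(ℝ²)}²`. -/
def sixNormSq (f : Plane → ℂ) : ℝ≥0∞ := (∫⁻ x, ‖f x‖ₑ ^ 6) ^ (1 / 3 : ℝ)

/-- The square of the right side of the `ℓ²L⁶` decoupling inequality. -/
def capSum (L : ℕ) (f : ℕ → Plane → ℂ) : ℝ≥0∞ := ∑ k ∈ Finset.range L, sixNormSq (f k)

/-- The sixth power of the `ℓ²L⁶` decoupling constant of `n ^ m` consecutive arcs is at most `E`,
at every scale `δ`. By parabolic rescaling this does not depend on `δ`; quantifying over `δ` makes
the rescaling unnecessary. -/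
def DecouplingBound (n m : ℕ) (E : ℝ≥0∞) : Prop :=
  ∀ δ : ℝ, 0 < δ → ∀ (a : ℝ) (f : ℕ → Plane → ℂ), IsCapFamily δ a (n ^ m) f →
    ∫⁻ x, ‖∑ k ∈ Finset.range (n ^ m), f k x‖ₑ ^ 6 ≤ E * capSum (n ^ m) f ^ 3

/-- The asymmetric bilinear decoupling inequality for two arcs of lengths `δ n ^ p` and `δ n ^ p'`
whose distance is at least `δ n ^ (m - 1)`. -/
def BilinearBound (n m p p' : ℕ) (X : ℝ≥0∞) : Prop :=
  ∀ δ : ℝ, 0 < δ → ∀ (a a' : ℝ) (f g : ℕ → Plane → ℂ),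
    IsCapFamily δ a (n ^ p) f → IsCapFamily δ a' (n ^ p') g →
    (a + δ * n ^ p + δ * n ^ (m - 1) ≤ a' ∨ a' + δ * n ^ p' + δ * n ^ (m - 1) ≤ a) →
    ∫⁻ x, ‖∑ k ∈ Finset.range (n ^ p), f k x‖ₑ ^ 2 * ‖∑ k ∈ Finset.range (n ^ p'), g k x‖ₑ ^ 4
      ≤ X * capSum (n ^ p) f * capSum (n ^ p') g ^ 2

theorem sum_range_mul_eq {M : Type*} [AddCommMonoid M] (L K : ℕ) (f : ℕ → M) :
    ∑ k ∈ Finset.range (L * K), f k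
      = ∑ i ∈ Finset.range L, ∑ k ∈ Finset.range K, f (i * K + k) := by
  induction L with
  | zero => simp
  | succ L ih => rw [Nat.succ_mul, Finset.sum_range_add, ih, Finset.sum_range_succ]

theorem IsCapFamily.hasSpectrum_sum {δ a : ℝ} {L : ℕ} {f : ℕ → Plane → ℂ} (hδ : 0 < δ)
    (hf : IsCapFamily δ a L f) :
    HasSpectrum (capNhd δ a (L * δ)) fun x => ∑ k ∈ Finset.range L, f k x := by
  have : HasSpectrum (capNhd δ a (L * δ)) (∑ k ∈ Finset.range L, f k) := by
    refine HasSpectrum.sum _ fun k hk => (hf k (Finset.mem_range.1 hk)).mono ?_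
    have hk : (k : ℝ) + 1 ≤ L := by exact_mod_cast Finset.mem_range.1 hk
    have hk0 : (0 : ℝ) ≤ k * δ := by positivity
    exact capNhd_subset (by linarith) (by nlinarith)
  convert this using 1
  ext x
  simp

theorem IsCapFamily.block {δ a : ℝ} {L K : ℕ} {f : ℕ → Plane → ℂ}
    (hf : IsCapFamily δ a (L * K) f) {i : ℕ} (hi : i < L) :
    IsCapFamily δ (a + i * (K * δ)) K fun k => f (i * K + k) := by
  intro k hk
  have hlt : i * K + k < L * K := by
    calc i * K + k < i * K + K := by omega
      _ = (i + 1) * K := by ring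
      _ ≤ L * K := Nat.mul_le_mul_right K hi
  convert hf _ hlt using 2
  push_cast
  ring

theorem capSum_mul (L K : ℕ) (f : ℕ → Plane → ℂ) :
    capSum (L * K) f = ∑ i ∈ Finset.range L, capSum K fun k => f (i * K + k) :=
  sum_range_mul_eq L K _

theorem IsCapFamily.measurable_sum {δ a : ℝ} {L : ℕ} {f : ℕ → Plane → ℂ} (hδ : 0 < δ)
    (hf : IsCapFamily δ a L f) : Measurable fun x => ‖∑ k ∈ Finset.range L, f k x‖ₑ :=
  (hf.hasSpectrum_sum hδ).continuous.measurable.enorm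

/-- Shortening the first arc from `δ n ^ p` to `δ n ^ p₁` costs only a factor `36 n`, by transverse
orthogonality, as long as `p₁` is at least twice the level of the second arc. -/
theorem BilinearBound.of_shorter {n m b p : ℕ} {X : ℝ≥0∞} (hn : 2 ≤ n) (hb1 : 1 ≤ b)
    (hb : 2 * b ≤ m) (hp : m - 2 * b ≤ p)
    (h : BilinearBound n m (m - 2 * b) (m - b) X) :
    BilinearBound n m p (m - b) ((36 * n : ℕ) * X) := by
  intro δ hδ a a' f g hf hg hsep
  have hn' : (2 : ℝ) ≤ n := by exact_mod_cast hn
  set K := n ^ (m - 2 * b) with hK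
  set L := n ^ (p - (m - 2 * b)) with hL
  have hLK : n ^ p = L * K := by rw [hL, hK, ← pow_add]; congr 1; omega
  have hLKr : (n : ℝ) ^ p = L * K := by exact_mod_cast hLK
  rw [hLK] at hf ⊢
  have hKp : (1 : ℝ) ≤ K := by
    rw [hK]; exact_mod_cast Nat.one_le_pow _ _ (by omega)
  have hδp : ∀ k : ℕ, 1 ≤ k → 2 * δ ≤ δ * (n : ℝ) ^ k := by
    intro k hk
    have : (n : ℝ) ^ 1 ≤ (n : ℝ) ^ k := pow_le_pow_right₀ (by linarith) hk
    nlinarith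
  have hsq : (n ^ (m - b) * δ : ℝ) ^ 2 = n * (δ * n ^ (m - 1)) * (K * δ) := by
    have : (n : ℝ) ^ (m - b) * n ^ (m - b) = n * n ^ (m - 1) * K := by
      rw [hK]; push_cast
      rw [← pow_succ', ← pow_add, ← pow_add]; congr 1; omega
    linear_combination δ ^ 2 * this
  have hsep' : a + L * (K * δ) + δ * n ^ (m - 1) ≤ a' ∨
      a' + ((n ^ (m - b) : ℕ) * δ) + δ * n ^ (m - 1) ≤ a := by
    push_cast
    rw [hLKr] at hsep
    rcases hsep with h | h
    · left; linarith
    · right; linarith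
  have orth := lintegral_sum_sq_mul_pow_four_le (n := n) (L := L) (δ := δ)
    (s := δ * n ^ (m - 1)) (a := a) (a' := a') (ℓ₁ := K * δ) (ℓ₂ := (n ^ (m - b) : ℕ) * δ)
    (F := fun i x => ∑ k ∈ Finset.range K, f (i * K + k) x)
    (G := fun x => ∑ k ∈ Finset.range (n ^ (m - b)), g k x) (by omega) hδ
    (hδp _ (by omega)) (by nlinarith) ?_ ?_
    (fun i hi => (hf.block hi).hasSpectrum_sum hδ) (hg.hasSpectrum_sum hδ) hsep'
  · simp_rw [sum_range_mul_eq L K]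
    refine orth.trans ?_
    calc ((36 * n : ℕ) : ℝ≥0∞) * ∑ i ∈ Finset.range L,
          ∫⁻ x, ‖∑ k ∈ Finset.range K, f (i * K + k) x‖ₑ ^ 2
            * ‖∑ k ∈ Finset.range (n ^ (m - b)), g k x‖ₑ ^ 4
        ≤ (36 * n : ℕ) * ∑ i ∈ Finset.range L,
            X * capSum K (fun k => f (i * K + k)) * capSum (n ^ (m - b)) g ^ 2 := by
          gcongr with i hi
          have hi := Finset.mem_range.1 hi
          have hiL : (i : ℝ) + 1 ≤ L := by exact_mod_cast hi
          have hKδ : 0 < K * δ := by positivity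
          have h1 : (i : ℝ) * (K * δ) + K * δ ≤ L * (K * δ) := by nlinarith
          have h2 : 0 ≤ (i : ℝ) * (K * δ) := by positivity
          have hKr : (n : ℝ) ^ (m - 2 * b) = K := by rw [hK]; push_cast; rfl
          refine h δ hδ _ a' _ g (hf.block hi) hg ?_
          rw [hKr]
          push_cast at hsep'
          rcases hsep' with h | h
          · left; linarith
          · right; linarith
      _ = (36 * n : ℕ) * X * capSum (L * K) f * capSum (n ^ (m - b)) g ^ 2 := by
          rw [capSum_mul, ← Finset.sum_mul, ← Finset.mul_sum]
          ring
  · push_cast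
    have : (1 : ℝ) ≤ n ^ (m - b) := one_le_pow₀ (by linarith)
    nlinarith
  · push_cast
    exact hsq.le

theorem lintegral_mul_sq_le {α : Type*} [MeasurableSpace α] {μ : Measure α} {f g : α → ℝ≥0∞}
    (hf : AEMeasurable f μ) (hg : AEMeasurable g μ) :
    (∫⁻ x, f x * g x ∂μ) ^ 2 ≤ (∫⁻ x, f x ^ 2 ∂μ) * ∫⁻ x, g x ^ 2 ∂μ := by
  have h := ENNReal.lintegral_mul_le_Lp_mul_Lq μ
    (Real.HolderConjugate.two_two : (2 : ℝ).HolderConjugate 2) hf hg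
  simp only [Pi.mul_apply, ENNReal.rpow_two] at h
  calc (∫⁻ x, f x * g x ∂μ) ^ 2
      ≤ ((∫⁻ x, f x ^ 2 ∂μ) ^ (1 / 2 : ℝ) * (∫⁻ x, g x ^ 2 ∂μ) ^ (1 / 2 : ℝ)) ^ 2 := by gcongr
    _ = _ := by
      rw [mul_pow, ← ENNReal.rpow_mul_natCast, ← ENNReal.rpow_mul_natCast]
      norm_num

theorem sixNormSq_pow_three (f : Plane → ℂ) : sixNormSq f ^ 3 = ∫⁻ x, ‖f x‖ₑ ^ 6 := by
  rw [sixNormSq, ← ENNReal.rpow_mul_natCast]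
  norm_num

theorem sum_pow_three_le (s : Finset ℕ) (S : ℕ → ℝ≥0∞) :
    ∑ i ∈ s, S i ^ 3 ≤ (∑ i ∈ s, S i) ^ 3 := by
  calc ∑ i ∈ s, S i ^ 3 ≤ ∑ i ∈ s, S i * (∑ i ∈ s, S i) ^ 2 := by
        gcongr with i hi
        rw [pow_succ']
        gcongr
        exact Finset.single_le_sum (fun _ _ => zero_le) hi
    _ = (∑ i ∈ s, S i) ^ 3 := by rw [← Finset.sum_mul, pow_succ' _ 2]

theorem DecouplingBound.mono {n m : ℕ} {E E' : ℝ≥0∞} (h : DecouplingBound n m E) (hE : E ≤ E') :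
    DecouplingBound n m E' := fun δ hδ a f hf => (h δ hδ a f hf).trans (by gcongr)

theorem BilinearBound.mono {n m p p' : ℕ} {X X' : ℝ≥0∞} (h : BilinearBound n m p p' X)
    (hX : X ≤ X') : BilinearBound n m p p' X' :=
  fun δ hδ a a' f g hf hg hs => (h δ hδ a a' f g hf hg hs).trans (by gcongr)

/-- Exchanging the roles of the two arcs by Cauchy-Schwarz: `|f|²|g|⁴ = (|f|²|g|) |g|³`. -/
theorem BilinearBound.swap {n m p p' : ℕ} {X E Y : ℝ≥0∞} (h : BilinearBound n m p p' X)
    (hE : DecouplingBound n p E) (hY : X * E ≤ Y ^ 2) : BilinearBound n m p' p Y := by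
  intro δ hδ a a' f g hf hg hsep
  have h1 := h δ hδ a' a g f hg hf hsep.symm
  have h2 := hE δ hδ a' g hg
  have mf := hf.measurable_sum hδ
  have mg := hg.measurable_sum hδ
  set F : Plane → ℝ≥0∞ := fun x => ‖∑ k ∈ Finset.range (n ^ p'), f k x‖ₑ
  set G : Plane → ℝ≥0∞ := fun x => ‖∑ k ∈ Finset.range (n ^ p), g k x‖ₑ
  set Sf := capSum (n ^ p') f
  set Sg := capSum (n ^ p) g
  have key : (∫⁻ x, F x ^ 2 * G x ^ 4) ^ 2 ≤ (Y * Sf * Sg ^ 2) ^ 2 := by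
    calc (∫⁻ x, F x ^ 2 * G x ^ 4) ^ 2 = (∫⁻ x, (F x ^ 2 * G x) * G x ^ 3) ^ 2 := by
          congr 2; ext x; ring
      _ ≤ (∫⁻ x, (F x ^ 2 * G x) ^ 2) * ∫⁻ x, (G x ^ 3) ^ 2 :=
          lintegral_mul_sq_le ((mf.pow_const 2).mul mg).aemeasurable (mg.pow_const 3).aemeasurable
      _ = (∫⁻ x, G x ^ 2 * F x ^ 4) * ∫⁻ x, G x ^ 6 := by
          congr 2 <;> (ext x; ring)
      _ ≤ (X * Sg * Sf ^ 2) * (E * Sg ^ 3) := mul_le_mul' h1 h2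
      _ = (X * E) * (Sf * Sg ^ 2) ^ 2 := by ring
      _ ≤ Y ^ 2 * (Sf * Sg ^ 2) ^ 2 := by gcongr
      _ = (Y * Sf * Sg ^ 2) ^ 2 := by ring
  exact (ENNReal.pow_le_pow_left_iff (by norm_num)).1 key

/-- Hölder's inequality bounds the bilinear constant by the linear one. -/
theorem DecouplingBound.bilinearBound {n m p p' : ℕ} {E : ℝ≥0∞} (h : DecouplingBound n p E)
    (h' : DecouplingBound n p' E) : BilinearBound n m p p' E := by
  intro δ hδ a a' f g hf hg _
  have h1 := h δ hδ a f hf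
  have h2 := h' δ hδ a' g hg
  have mf := hf.measurable_sum hδ
  have mg := hg.measurable_sum hδ
  set F : Plane → ℝ≥0∞ := fun x => ‖∑ k ∈ Finset.range (n ^ p), f k x‖ₑ
  set G : Plane → ℝ≥0∞ := fun x => ‖∑ k ∈ Finset.range (n ^ p'), g k x‖ₑ
  set Sf := capSum (n ^ p) f
  set Sg := capSum (n ^ p') g
  have c1 : ∀ t : ℝ≥0∞, (t ^ 3) ^ (1 / 3 : ℝ) = t := fun t => by
    rw [← ENNReal.rpow_natCast_mul]; norm_num
  have c2 : ∀ t : ℝ≥0∞, (t ^ 3) ^ (2 / 3 : ℝ) = t ^ 2 := fun t => by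
    rw [← ENNReal.rpow_natCast_mul]; norm_num
  calc ∫⁻ x, F x ^ 2 * G x ^ 4
      = ∫⁻ x, (F x ^ 6) ^ (1 / 3 : ℝ) * (G x ^ 6) ^ (2 / 3 : ℝ) := by
        congr 1; ext x
        rw [show F x ^ 6 = (F x ^ 2) ^ 3 by ring, show G x ^ 6 = (G x ^ 2) ^ 3 by ring, c1, c2]
        ring
    _ ≤ (∫⁻ x, F x ^ 6) ^ (1 / 3 : ℝ) * (∫⁻ x, G x ^ 6) ^ (2 / 3 : ℝ) :=
        ENNReal.lintegral_mul_norm_pow_le (mf.pow_const 6).aemeasurable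
          (mg.pow_const 6).aemeasurable (by norm_num) (by norm_num) (by norm_num)
    _ ≤ (E * Sf ^ 3) ^ (1 / 3 : ℝ) * (E * Sg ^ 3) ^ (2 / 3 : ℝ) := by gcongr
    _ = (E ^ (1 / 3 : ℝ) * E ^ (2 / 3 : ℝ)) * Sf * Sg ^ 2 := by
        rw [ENNReal.mul_rpow_of_nonneg _ _ (by norm_num),
          ENNReal.mul_rpow_of_nonneg _ _ (by norm_num), c1, c2]
        ring
    _ = E * Sf * Sg ^ 2 := by
        rw [← ENNReal.rpow_add_of_nonneg _ _ (by norm_num) (by norm_num)]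
        norm_num

/-- The triangle inequality, in wasteful form. -/
theorem decouplingBound_trivial (n m : ℕ) : DecouplingBound n m ((n ^ m : ℕ) ^ 6) := by
  intro δ hδ a f hf
  set N := n ^ m
  have hm : ∀ k ∈ Finset.range N, Measurable fun x => ‖f k x‖ₑ ^ 6 := fun k hk =>
    (hf k (Finset.mem_range.1 hk)).continuous.measurable.enorm.pow_const 6
  have hpt : ∀ x, ‖∑ k ∈ Finset.range N, f k x‖ₑ ^ 6
      ≤ (N : ℝ≥0∞) ^ 6 * ∑ k ∈ Finset.range N, ‖f k x‖ₑ ^ 6 := by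
    intro x
    rcases (Finset.range N).eq_empty_or_nonempty with h | h
    · simp [h]
    obtain ⟨j, hj, hmax⟩ := Finset.exists_max_image _ (fun k => ‖f k x‖ₑ) h
    calc ‖∑ k ∈ Finset.range N, f k x‖ₑ ^ 6 ≤ (∑ k ∈ Finset.range N, ‖f k x‖ₑ) ^ 6 := by
          gcongr; exact enorm_sum_le _ _
      _ ≤ (N * ‖f j x‖ₑ) ^ 6 := by
          gcongr
          simpa using Finset.sum_le_card_nsmul _ _ _ hmax
      _ = (N : ℝ≥0∞) ^ 6 * ‖f j x‖ₑ ^ 6 := mul_pow _ _ _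
      _ ≤ _ := by
          gcongr
          exact Finset.single_le_sum (f := fun k => ‖f k x‖ₑ ^ 6) (fun _ _ => zero_le) hj
  calc ∫⁻ x, ‖∑ k ∈ Finset.range N, f k x‖ₑ ^ 6
      ≤ ∫⁻ x, (N : ℝ≥0∞) ^ 6 * ∑ k ∈ Finset.range N, ‖f k x‖ₑ ^ 6 := lintegral_mono hpt
    _ = (N : ℝ≥0∞) ^ 6 * ∑ k ∈ Finset.range N, sixNormSq (f k) ^ 3 := by
        rw [lintegral_const_mul' _ _ (by finiteness), lintegral_finsetSum _ hm]
        simp_rw [sixNormSq_pow_three]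
    _ ≤ (N : ℝ≥0∞) ^ 6 * capSum N f ^ 3 := by
        gcongr
        exact sum_pow_three_le _ _

/-! ### The broad-narrow argument -/

/-- If the terms that are at least `1 / n` times the largest one are all adjacent to it, the sum is
controlled by the largest term; otherwise it is controlled by a product of two nonadjacent terms. -/
theorem norm_sum_pow_six_le_broad_narrow (n : ℕ) (z : ℕ → ℂ) :
    ‖∑ i ∈ Finset.range n, z i‖ ^ 6 ≤ 4 ^ 6 * ∑ i ∈ Finset.range n, ‖z i‖ ^ 6
      + n ^ 8 * ∑ i ∈ Finset.range n, ∑ j ∈ Finset.range n,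
          if i + 2 ≤ j ∨ j + 2 ≤ i then ‖z i‖ ^ 2 * ‖z j‖ ^ 4 else 0 := by
  rcases (Finset.range n).eq_empty_or_nonempty with h | h
  · simp [h]
  have hn : 0 < n := Nat.pos_of_ne_zero (by simpa using h)
  have hn' : (0 : ℝ) < n := by exact_mod_cast hn
  obtain ⟨j, hj, hmax⟩ := Finset.exists_max_image _ (fun k => ‖z k‖) h
  have hterm : ∀ i ∈ Finset.range n, ∀ k ∈ Finset.range n,
      0 ≤ if i + 2 ≤ k ∨ k + 2 ≤ i then ‖z i‖ ^ 2 * ‖z k‖ ^ 4 else 0 := fun i _ k _ => by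
    split_ifs <;> positivity
  by_cases hbroad : ∃ i ∈ Finset.range n, (i + 2 ≤ j ∨ j + 2 ≤ i) ∧ ‖z j‖ ≤ n * ‖z i‖
  · obtain ⟨i, hi, hij, hle⟩ := hbroad
    have h1 : ‖∑ i ∈ Finset.range n, z i‖ ≤ n * ‖z j‖ := by
      refine (norm_sum_le _ _).trans ?_
      simpa using Finset.sum_le_card_nsmul _ _ _ hmax
    have h2 : ‖z i‖ ^ 2 * ‖z j‖ ^ 4 ≤ ∑ i ∈ Finset.range n, ∑ j ∈ Finset.range n,
          if i + 2 ≤ j ∨ j + 2 ≤ i then ‖z i‖ ^ 2 * ‖z j‖ ^ 4 else 0 := by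
      calc ‖z i‖ ^ 2 * ‖z j‖ ^ 4
          = if i + 2 ≤ j ∨ j + 2 ≤ i then ‖z i‖ ^ 2 * ‖z j‖ ^ 4 else 0 := by rw [if_pos hij]
        _ ≤ ∑ k ∈ Finset.range n, if i + 2 ≤ k ∨ k + 2 ≤ i then ‖z i‖ ^ 2 * ‖z k‖ ^ 4 else 0 :=
            Finset.single_le_sum (f := fun k => if i + 2 ≤ k ∨ k + 2 ≤ i then
              ‖z i‖ ^ 2 * ‖z k‖ ^ 4 else 0) (hterm i hi) hj
        _ ≤ _ := Finset.single_le_sum (f := fun i => ∑ k ∈ Finset.range n,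
              if i + 2 ≤ k ∨ k + 2 ≤ i then ‖z i‖ ^ 2 * ‖z k‖ ^ 4 else 0)
              (fun i hi => Finset.sum_nonneg (hterm i hi)) hi
    calc ‖∑ i ∈ Finset.range n, z i‖ ^ 6 ≤ (n * ‖z j‖) ^ 6 := by gcongr
      _ = n ^ 6 * ‖z j‖ ^ 2 * ‖z j‖ ^ 4 := by ring
      _ ≤ n ^ 6 * (n * ‖z i‖) ^ 2 * ‖z j‖ ^ 4 := by gcongr
      _ = n ^ 8 * (‖z i‖ ^ 2 * ‖z j‖ ^ 4) := by ring
      _ ≤ _ := by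
        have : 0 ≤ 4 ^ 6 * ∑ i ∈ Finset.range n, ‖z i‖ ^ 6 := by positivity
        have := mul_le_mul_of_nonneg_left h2 (by positivity : (0 : ℝ) ≤ n ^ 8)
        linarith
  · push Not at hbroad
    have h1 : ∀ i ∈ Finset.range n,
        ‖z i‖ ≤ (if i ∈ ({j - 1, j, j + 1} : Finset ℕ) then ‖z j‖ else 0) + ‖z j‖ / n := by
      intro i hi
      split_ifs with hadj
      · have := hmax i hi
        have : 0 ≤ ‖z j‖ / n := by positivity
        linarith
      · simp only [Finset.mem_insert, Finset.mem_singleton] at hadj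
        have := hbroad i hi (by omega)
        rw [zero_add, le_div_iff₀ hn', mul_comm]
        exact this.le
    have h2 : ‖∑ i ∈ Finset.range n, z i‖ ≤ 4 * ‖z j‖ := by
      calc ‖∑ i ∈ Finset.range n, z i‖ ≤ ∑ i ∈ Finset.range n, ‖z i‖ := norm_sum_le _ _
        _ ≤ ∑ i ∈ Finset.range n,
            ((if i ∈ ({j - 1, j, j + 1} : Finset ℕ) then ‖z j‖ else 0) + ‖z j‖ / n) :=
            Finset.sum_le_sum h1
        _ = ((Finset.range n).filter (· ∈ ({j - 1, j, j + 1} : Finset ℕ))).card * ‖z j‖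
            + ‖z j‖ := by
            rw [Finset.sum_add_distrib, ← Finset.sum_filter, Finset.sum_const, Finset.sum_const,
              nsmul_eq_mul, nsmul_eq_mul, Finset.card_range, mul_div_cancel₀ _ hn'.ne']
        _ ≤ 3 * ‖z j‖ + ‖z j‖ := by
            gcongr
            have : ((Finset.range n).filter (· ∈ ({j - 1, j, j + 1} : Finset ℕ))).card ≤ 3 :=
              (Finset.card_le_card fun x hx => (Finset.mem_filter.1 hx).2).trans
                Finset.card_le_three
            exact_mod_cast this
        _ = 4 * ‖z j‖ := by ring
    calc ‖∑ i ∈ Finset.range n, z i‖ ^ 6 ≤ (4 * ‖z j‖) ^ 6 := by gcongr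
      _ = 4 ^ 6 * ‖z j‖ ^ 6 := by ring
      _ ≤ 4 ^ 6 * ∑ i ∈ Finset.range n, ‖z i‖ ^ 6 := by
        gcongr
        exact Finset.single_le_sum (f := fun i => ‖z i‖ ^ 6) (fun _ _ => by positivity) hj
      _ ≤ _ := le_add_of_nonneg_right (mul_nonneg (by positivity)
          (Finset.sum_nonneg fun i hi => Finset.sum_nonneg (hterm i hi)))

theorem enorm_sum_pow_six_le_broad_narrow (n : ℕ) (z : ℕ → ℂ) :
    ‖∑ i ∈ Finset.range n, z i‖ₑ ^ 6 ≤ 4 ^ 6 * ∑ i ∈ Finset.range n, ‖z i‖ₑ ^ 6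
      + n ^ 8 * ∑ i ∈ Finset.range n, ∑ j ∈ Finset.range n,
          if i + 2 ≤ j ∨ j + 2 ≤ i then ‖z i‖ₑ ^ 2 * ‖z j‖ₑ ^ 4 else 0 := by
  have h : ‖∑ i ∈ Finset.range n, z i‖₊ ^ 6 ≤ 4 ^ 6 * ∑ i ∈ Finset.range n, ‖z i‖₊ ^ 6
      + n ^ 8 * ∑ i ∈ Finset.range n, ∑ j ∈ Finset.range n,
          if i + 2 ≤ j ∨ j + 2 ≤ i then ‖z i‖₊ ^ 2 * ‖z j‖₊ ^ 4 else 0 := by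
    have := norm_sum_pow_six_le_broad_narrow n z
    rw [← NNReal.coe_le_coe]
    push_cast [apply_ite NNReal.toReal]
    exact this
  have h' := ENNReal.coe_le_coe.2 h
  push_cast [apply_ite ENNReal.ofNNReal] at h'
  exact h'

theorem DecouplingBound.of_bilinearBound {n m : ℕ} {E X : ℝ≥0∞} (hm : 1 ≤ m)
    (hE : DecouplingBound n (m - 1) E) (hX : BilinearBound n m (m - 1) (m - 1) X) :
    DecouplingBound n m (4 ^ 6 * E + n ^ 8 * X) := by
  intro δ hδ a f hf
  set K := n ^ (m - 1) with hK
  have hnK : n ^ m = n * K := by rw [hK, ← pow_succ']; congr 1; omega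
  have hKr : (n : ℝ) ^ (m - 1) = K := by rw [hK]; push_cast; rfl
  rw [hnK] at hf ⊢
  have hfi : ∀ i ∈ Finset.range n, IsCapFamily δ (a + i * (K * δ)) K fun k => f (i * K + k) :=
    fun i hi => hf.block (Finset.mem_range.1 hi)
  set F : ℕ → Plane → ℂ := fun i x => ∑ k ∈ Finset.range K, f (i * K + k) x with hF
  set S : ℕ → ℝ≥0∞ := fun i => capSum K fun k => f (i * K + k)
  have mF : ∀ i ∈ Finset.range n, Measurable fun x => ‖F i x‖ₑ :=
    fun i hi => (hfi i hi).measurable_sum hδ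
  have hnar : ∀ i ∈ Finset.range n, ∫⁻ x, ‖F i x‖ₑ ^ 6 ≤ E * S i ^ 3 :=
    fun i hi => hE δ hδ _ _ (hfi i hi)
  have hbr : ∀ i ∈ Finset.range n, ∀ j ∈ Finset.range n,
      ∫⁻ x, (if i + 2 ≤ j ∨ j + 2 ≤ i then ‖F i x‖ₑ ^ 2 * ‖F j x‖ₑ ^ 4 else 0)
        ≤ X * S i * S j ^ 2 := by
    intro i hi j hj
    split_ifs with hij
    · refine hX δ hδ _ _ _ _ (hfi i hi) (hfi j hj) ?_
      rw [hKr]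
      have hKδ : 0 ≤ K * δ := by positivity
      rcases hij with h | h
      · left
        have h : (i : ℝ) + 2 ≤ j := by exact_mod_cast h
        nlinarith
      · right
        have h : (j : ℝ) + 2 ≤ i := by exact_mod_cast h
        nlinarith
    · simp
  have mB : ∀ i ∈ Finset.range n, ∀ j ∈ Finset.range n, Measurable fun x =>
      if i + 2 ≤ j ∨ j + 2 ≤ i then ‖F i x‖ₑ ^ 2 * ‖F j x‖ₑ ^ 4 else 0 := by
    intro i hi j hj
    split_ifs
    · exact ((mF i hi).pow_const 2).mul ((mF j hj).pow_const 4)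
    · exact measurable_const
  have hS : capSum (n * K) f = ∑ i ∈ Finset.range n, S i := capSum_mul n K f
  simp_rw [sum_range_mul_eq n K]
  calc ∫⁻ x, ‖∑ i ∈ Finset.range n, F i x‖ₑ ^ 6
      ≤ ∫⁻ x, (4 ^ 6 * ∑ i ∈ Finset.range n, ‖F i x‖ₑ ^ 6
      + n ^ 8 * ∑ i ∈ Finset.range n, ∑ j ∈ Finset.range n,
          if i + 2 ≤ j ∨ j + 2 ≤ i then ‖F i x‖ₑ ^ 2 * ‖F j x‖ₑ ^ 4 else 0) :=
        lintegral_mono fun x => enorm_sum_pow_six_le_broad_narrow n fun i => F i x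
    _ = 4 ^ 6 * (∑ i ∈ Finset.range n, ∫⁻ x, ‖F i x‖ₑ ^ 6)
      + n ^ 8 * ∑ i ∈ Finset.range n, ∑ j ∈ Finset.range n,
          ∫⁻ x, if i + 2 ≤ j ∨ j + 2 ≤ i then ‖F i x‖ₑ ^ 2 * ‖F j x‖ₑ ^ 4 else 0 := by
        rw [lintegral_add_left, lintegral_const_mul' _ _ (by finiteness),
          lintegral_const_mul' _ _ (by finiteness),
          lintegral_finsetSum _ fun i hi => (mF i hi).pow_const 6,
          lintegral_finsetSum _ fun i hi => Finset.measurable_fun_sum _ (mB i hi)]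
        · congr 2
          exact Finset.sum_congr rfl fun i hi => lintegral_finsetSum _ (mB i hi)
        · exact (Finset.measurable_fun_sum _ fun i hi => (mF i hi).pow_const 6).const_mul _
    _ ≤ 4 ^ 6 * ∑ i ∈ Finset.range n, E * S i ^ 3
      + n ^ 8 * ∑ i ∈ Finset.range n, ∑ j ∈ Finset.range n, X * S i * S j ^ 2 := by
        gcongr with i hi i hi j hj
        · exact hnar i hi
        · exact hbr i hi j hj
    _ ≤ 4 ^ 6 * (E * capSum (n * K) f ^ 3) + n ^ 8 * (X * capSum (n * K) f ^ 3) := by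
        rw [hS]
        gcongr
        · rw [← Finset.mul_sum]
          gcongr
          exact sum_pow_three_le _ _
        · calc ∑ i ∈ Finset.range n, ∑ j ∈ Finset.range n, X * S i * S j ^ 2
              = X * ((∑ i ∈ Finset.range n, S i) * ∑ j ∈ Finset.range n, S j ^ 2) := by
                rw [Finset.sum_mul_sum, Finset.mul_sum]
                refine Finset.sum_congr rfl fun i _ => ?_
                rw [Finset.mul_sum]
                exact Finset.sum_congr rfl fun j _ => mul_assoc _ _ _
            _ ≤ X * ((∑ i ∈ Finset.range n, S i) * (∑ i ∈ Finset.range n, S i) ^ 2) := by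
                gcongr
                rw [sq (∑ i ∈ Finset.range n, S i), Finset.sum_mul]
                gcongr with j hj
                rw [sq]
                gcongr
                exact Finset.single_le_sum (fun _ _ => zero_le) hj
            _ = X * (∑ i ∈ Finset.range n, S i) ^ 3 := by rw [pow_succ' _ 2]
    _ = (4 ^ 6 * E + n ^ 8 * X) * capSum (n * K) f ^ 3 := by ring

/-! ### Iteration -/

/-- The bilinear constant after `d` rounds of exchanging the arcs and shortening the first one.
With `q = r²` the recursion `x i = 36 n (x (i + 1) A q ^ (m - 2 ^ (i + 1))) ^ (1 / 2)` is solved by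
`x i = (36 n)² A q ^ (m - 2 ^ i (j - i))`, where `i = j - d`. -/
theorem bilinearBound_of_decouplingBound_lt {n m j : ℕ} {A r : ℝ} (hn : 2 ≤ n)
    (hm : 2 ^ (j + 1) ≤ m) (hA : 0 < A) (hr : 1 ≤ r)
    (hE : ∀ m' < m, DecouplingBound n m' (ENNReal.ofReal (A * r ^ (2 * m')))) (d : ℕ) (hd : d ≤ j) :
    BilinearBound n m (m - 2 ^ (j - d)) (m - 2 ^ (j - d + 1))
      (ENNReal.ofReal ((36 * n) ^ 2 * A * r ^ (2 * m) / r ^ (2 * (2 ^ (j - d) * d)))) := by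
  have hn1 : (1 : ℝ) ≤ 36 * n := by
    have : (2 : ℝ) ≤ n := by exact_mod_cast hn
    linarith
  have hr0 : 0 < r := by linarith
  induction d with
  | zero =>
    have h0 : ∀ e : ℕ, 1 ≤ e → e ≤ m → DecouplingBound n (m - e)
        (ENNReal.ofReal ((36 * n) ^ 2 * A * r ^ (2 * m) / r ^ (2 * (2 ^ j * 0)))) := by
      intro e he hem
      refine (hE (m - e) (by omega)).mono (ENNReal.ofReal_le_ofReal ?_)
      rw [mul_zero, mul_zero, pow_zero, div_one]
      have h1 : r ^ (2 * (m - e)) ≤ r ^ (2 * m) := pow_le_pow_right₀ hr (by omega)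
      have h2 : (1 : ℝ) ≤ (36 * n) ^ 2 := one_le_pow₀ hn1
      calc A * r ^ (2 * (m - e)) ≤ A * r ^ (2 * m) := by gcongr
        _ ≤ (36 * n) ^ 2 * (A * r ^ (2 * m)) := le_mul_of_one_le_left (by positivity) h2
        _ = _ := by ring
    have hle : 2 ^ j ≤ m := le_trans (Nat.pow_le_pow_right (by norm_num) (by omega)) hm
    exact (h0 _ Nat.one_le_two_pow hle).bilinearBound (h0 _ Nat.one_le_two_pow hm)
  | succ d ih =>
    obtain ⟨i, hi⟩ : ∃ i, j - d = i + 1 := ⟨j - d - 1, by omega⟩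
    have hi' : j - (d + 1) = i := by omega
    have ih := ih (by omega)
    rw [hi] at ih
    rw [hi']
    have hb : 2 * 2 ^ (i + 1) ≤ m := by
      refine le_trans ?_ hm
      rw [← pow_succ']
      exact Nat.pow_le_pow_right (by norm_num) (by omega)
    have hpos : 1 ≤ 2 ^ i := Nat.one_le_two_pow
    have hpos' : 2 ^ (i + 1) = 2 * 2 ^ i := pow_succ' 2 i
    have hdec := hE (m - 2 ^ (i + 1)) (by omega)
    have hsw := ih.swap hdec
      (Y := ENNReal.ofReal (36 * n * A * r ^ (2 * m) / r ^ (2 * (2 ^ i * (d + 1))))) ?_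
    · rw [show 2 ^ (i + 1 + 1) = 2 * 2 ^ (i + 1) from pow_succ' 2 (i + 1)] at hsw
      refine (hsw.of_shorter hn Nat.one_le_two_pow hb (p := m - 2 ^ i) (by omega)).mono ?_
      rw [← ENNReal.ofReal_natCast, ← ENNReal.ofReal_mul (by positivity)]
      apply le_of_eq
      congr 1
      push_cast
      ring
    · rw [← ENNReal.ofReal_mul (by positivity), ← ENNReal.ofReal_pow (by positivity)]
      apply le_of_eq
      congr 1
      have hsplit : r ^ (2 * m) = r ^ (2 * (m - 2 ^ (i + 1))) * r ^ (2 * (2 * 2 ^ i)) := by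
        rw [← pow_add]; congr 1; omega
      have e1 : r ^ (2 * (2 ^ (i + 1) * d)) * r ^ (2 * (2 * 2 ^ i))
          = (r ^ (2 * (2 ^ i * (d + 1)))) ^ 2 := by
        rw [← pow_add, ← pow_mul, pow_succ 2 i]; congr 1; ring
      rw [div_pow, ← e1, div_mul_eq_mul_div,
        div_eq_div_iff (by positivity) (by positivity), hsplit]
      ring

/-- The decoupling constant of `n ^ m` arcs grows at most like `r ^ (2m)` in `m`, where
`r ^ (j + 1)` is a fixed power of `n` and `j` is the number of steps of the iteration. -/
theorem decouplingBound_of_iterate {n j : ℕ} {r : ℝ} (hn : 2 ≤ n) (hr : 2 * 4 ^ 6 ≤ r ^ 2)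
    (hr0 : 1 ≤ r) (hrj : 2 * 36 ^ 2 * (n : ℝ) ^ 10 ≤ r ^ (j + 1)) (m : ℕ) :
    DecouplingBound n m (ENNReal.ofReal ((n : ℝ) ^ (6 * 2 ^ (j + 1)) * r ^ (2 * m))) := by
  have hn' : (2 : ℝ) ≤ n := by exact_mod_cast hn
  set A : ℝ := (n : ℝ) ^ (6 * 2 ^ (j + 1)) with hAdef
  have hA : 0 < A := by positivity
  have hrpos : 0 < r := by linarith
  induction m using Nat.strong_induction_on with
  | _ m ih =>
    rcases lt_or_ge m (2 ^ (j + 1)) with hm | hm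
    · refine (decouplingBound_trivial n m).mono ?_
      rw [← ENNReal.ofReal_natCast, ← ENNReal.ofReal_pow (by positivity)]
      apply ENNReal.ofReal_le_ofReal
      have h1 : ((n ^ m : ℕ) : ℝ) ^ 6 ≤ A := by
        push_cast
        rw [← pow_mul, hAdef]
        exact pow_le_pow_right₀ (by linarith) (by omega)
      exact h1.trans (le_mul_of_one_le_right hA.le (one_le_pow₀ hr0))
    · have hm2 : 2 ≤ m := le_trans (by
        rw [pow_succ]; have := Nat.one_le_two_pow (n := j); omega) hm
      have h0 := bilinearBound_of_decouplingBound_lt hn hm hA hr0 ih j le_rfl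
      simp only [Nat.sub_self, pow_zero, zero_add, pow_one, one_mul] at h0
      have hsw := h0.swap (ih (m - 1) (by omega))
        (Y := ENNReal.ofReal (36 * n * A * r ^ (2 * m) / r ^ (j + 1))) ?_
      · have hbil := hsw.of_shorter hn le_rfl (b := 1) (p := m - 1) (by omega) (by omega)
        refine ((ih (m - 1) (by omega)).of_bilinearBound (by omega) hbil).mono ?_
        have e1 : (4 ^ 6 : ℝ≥0∞) = ENNReal.ofReal (4 ^ 6) := by norm_num
        have e2 : (n : ℝ≥0∞) ^ 8 = ENNReal.ofReal ((n : ℝ) ^ 8) := by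
          rw [ENNReal.ofReal_pow (by positivity), ENNReal.ofReal_natCast]
        rw [e1, e2, ← ENNReal.ofReal_natCast, ← ENNReal.ofReal_mul (by positivity),
          ← ENNReal.ofReal_mul (by positivity), ← ENNReal.ofReal_mul (by positivity),
          ← ENNReal.ofReal_add (by positivity) (by positivity)]
        apply ENNReal.ofReal_le_ofReal
        have hsplit : r ^ (2 * m) = r ^ (2 * (m - 1)) * r ^ 2 := by
          rw [← pow_add]; congr 1; omega
        have t1 : 4 ^ 6 * (A * r ^ (2 * (m - 1))) ≤ A * r ^ (2 * m) / 2 := by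
          rw [hsplit]
          have : 0 < A * r ^ (2 * (m - 1)) := by positivity
          nlinarith
        have t2 : (n : ℝ) ^ 8 * ((36 * n : ℕ) * (36 * n * A * r ^ (2 * m) / r ^ (j + 1)))
            ≤ A * r ^ (2 * m) / 2 := by
          have hj : 0 < r ^ (j + 1) := by positivity
          calc (n : ℝ) ^ 8 * ((36 * n : ℕ) * (36 * n * A * r ^ (2 * m) / r ^ (j + 1)))
              = (2 * 36 ^ 2 * (n : ℝ) ^ 10) / r ^ (j + 1) * (A * r ^ (2 * m) / 2) := by
                push_cast; field_simp
            _ ≤ 1 * (A * r ^ (2 * m) / 2) := by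
                gcongr
                rwa [div_le_one hj]
            _ = _ := one_mul _
        linarith
      · rw [← ENNReal.ofReal_mul (by positivity), ← ENNReal.ofReal_pow (by positivity)]
        apply le_of_eq
        congr 1
        have hsplit : r ^ (2 * m) = r ^ (2 * (m - 1)) * r ^ 2 := by
          rw [← pow_add]; congr 1; omega
        have e1 : r ^ (2 * j) * r ^ 2 = (r ^ (j + 1)) ^ 2 := by
          rw [← pow_add, ← pow_mul]; congr 1; ring
        rw [div_pow, ← e1, div_mul_eq_mul_div,
          div_eq_div_iff (by positivity) (by positivity), hsplit]
        ring

/-! ### A band-limited window adapted to a square -/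

theorem inner_plane (x y : Plane) : inner ℝ x y = x 0 * y 0 + x 1 * y 1 := by
  simp [PiLp.inner_apply, Fin.sum_univ_two, mul_comm]

theorem integral_fourierChar_Icc {κ : ℝ} (hκ : 0 < κ) (y : ℝ) :
    ∫ t, (Icc (-κ) κ).indicator (fun t => ((𝐞 (-(t * y)) : Circle) : ℂ)) t
      = 2 * κ * Real.sinc (2 * Real.pi * κ * y) := by
  rw [integral_indicator measurableSet_Icc, integral_Icc_eq_integral_Ioc,
    ← intervalIntegral.integral_of_le (by linarith)]
  rcases eq_or_ne y 0 with rfl | hy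
  · simp; ring
  have hc : (-(2 * Real.pi * y)) ≠ 0 := by
    have := Real.pi_ne_zero
    simp [hy, this]
  have h := intervalIntegral.integral_comp_mul_left (a := -κ) (b := κ)
    (fun t : ℝ => Complex.exp (t * Complex.I)) hc
  rw [show -(2 * Real.pi * y) * -κ = -(-(2 * Real.pi * κ * y)) by ring,
    show -(2 * Real.pi * y) * κ = -(2 * Real.pi * κ * y) by ring,
    integral_exp_mul_I_eq_sinc, Real.sinc_neg] at h
  calc ∫ t in (-κ)..κ, ((𝐞 (-(t * y)) : Circle) : ℂ)
      = ∫ t in (-κ)..κ, Complex.exp (((-(2 * Real.pi * y) * t : ℝ) : ℂ) * Complex.I) := by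
        congr 1
        ext t
        rw [Real.fourierChar_apply]
        congr 3
        ring
    _ = 2 * κ * Real.sinc (2 * Real.pi * κ * y) := by
        rw [h, Complex.real_smul]
        have h1 : (y : ℂ) ≠ 0 := by exact_mod_cast hy
        have h2 : (Real.pi : ℂ) ≠ 0 := by exact_mod_cast Real.pi_ne_zero
        push_cast
        field_simp

/-- The product of two `sinc` functions, whose Fourier transform is supported in the square of
half side `κ`. -/
def sincProd (κ : ℝ) (x : Plane) : ℂ :=
  (Real.sinc (2 * Real.pi * κ * x 0) * Real.sinc (2 * Real.pi * κ * x 1) : ℝ)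

/-- The square of frequencies `|ζ i| ≤ κ`. -/
def freqSquare (κ : ℝ) : Set Plane := {ζ | ∀ i, |ζ i| ≤ κ}

theorem hasSpectrum_sincProd {κ : ℝ} (hκ : 0 < κ) : HasSpectrum (freqSquare κ) (sincProd κ) := by
  set F : Plane → ℂ := fun ζ => ∏ i, (Icc (-κ) κ).indicator (fun _ => (1 / (2 * κ) : ℂ)) (ζ i)
    with hF
  have hmp : MeasurePreserving (WithLp.toLp 2 : (Fin 2 → ℝ) → Plane) := PiLp.volume_preserving_toLp _
  have hemb : MeasurableEmbedding (WithLp.toLp 2 : (Fin 2 → ℝ) → Plane) :=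
    (MeasurableEquiv.toLp 2 (Fin 2 → ℝ)).measurableEmbedding
  have hint1 : Integrable ((Icc (-κ) κ).indicator (fun _ => (1 / (2 * κ) : ℂ))) :=
    (integrable_indicator_iff measurableSet_Icc).2 (integrableOn_const (by simp))
  refine ⟨F, ?_, ⟨1 / (2 * κ) * (1 / (2 * κ)), ?_⟩, ?_, ?_⟩
  · rw [← hmp.integrable_comp_emb hemb]
    exact Integrable.fintype_prod (f := fun _ : Fin 2 =>
      (Icc (-κ) κ).indicator (fun _ => (1 / (2 * κ) : ℂ))) fun _ => hint1
  · intro ζ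
    have h : ∀ t, ‖(Icc (-κ) κ).indicator (fun _ => (1 / (2 * κ) : ℂ)) t‖ ≤ 1 / (2 * κ) := by
      intro t
      refine (norm_indicator_le_norm_self _ _).trans (le_of_eq ?_)
      simp [abs_of_pos hκ]
    rw [hF]
    simp only [Fin.prod_univ_two, norm_mul]
    exact mul_le_mul (h _) (h _) (norm_nonneg _) (by positivity)
  · intro ζ hζ i
    have h := Finset.prod_ne_zero_iff.1 hζ i (Finset.mem_univ i)
    have : ζ i ∈ Icc (-κ) κ := by
      by_contra hn
      exact h (indicator_of_notMem hn _)
    simpa [abs_le, and_comm, neg_le] using this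
  · ext x
    rw [Real.fourier_eq, ← hmp.integral_comp hemb]
    have : ∀ v : Fin 2 → ℝ, 𝐞 (-inner ℝ (WithLp.toLp 2 v : Plane) x) • F (WithLp.toLp 2 v)
        = ∏ i, ((1 / (2 * κ) : ℂ) *
          (Icc (-κ) κ).indicator (fun t => ((𝐞 (-(t * x i)) : Circle) : ℂ)) (v i)) := by
      intro v
      have hch : 𝐞 (-inner ℝ (WithLp.toLp 2 v : Plane) x)
          = 𝐞 (-(v 0 * x 0)) * 𝐞 (-(v 1 * x 1)) := by
        rw [← AddChar.map_add_eq_mul, inner_plane]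
        congr 1
        simp; ring
      rw [hch, hF, Circle.smul_def, Circle.coe_mul, smul_eq_mul]
      simp only [Fin.prod_univ_two, indicator]
      split_ifs <;> ring
    simp_rw [this]
    rw [integral_fintype_prod_volume_eq_prod (fun i t => (1 / (2 * κ) : ℂ) *
      (Icc (-κ) κ).indicator (fun t => ((𝐞 (-(t * x i)) : Circle) : ℂ)) t)]
    simp_rw [integral_const_mul, integral_fourierChar_Icc hκ, Fin.prod_univ_two, sincProd]
    have : (κ : ℂ) ≠ 0 := by exact_mod_cast hκ.ne'
    push_cast
    field_simp

theorem HasSpectrum.translate {Ω : Set Plane} {f : Plane → ℂ} (h : HasSpectrum Ω f) (c : Plane) :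
    HasSpectrum Ω fun x => f (x - c) := by
  obtain ⟨F, h1, ⟨C, h2⟩, h3, rfl⟩ := h
  have hn : ∀ ζ, ‖𝐞 (inner ℝ ζ c) • F ζ‖ = ‖F ζ‖ := fun ζ => Circle.norm_smul _ _
  refine ⟨fun ζ => 𝐞 (inner ℝ ζ c) • F ζ, ?_, ⟨C, fun ζ => (hn ζ).trans_le (h2 ζ)⟩, fun ζ hζ => ?_, ?_⟩
  · refine h1.norm.mono' ?_ (ae_of_all _ fun ζ => (hn ζ).le)
    have hc : Continuous fun ζ : Plane => ((𝐞 (inner ℝ ζ c) : Circle) : ℂ) := by fun_prop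
    exact hc.aestronglyMeasurable.smul h1.aestronglyMeasurable
  · refine h3 ζ fun h0 => hζ ?_
    simp [h0]
  · ext x
    rw [Real.fourier_eq, Real.fourier_eq]
    congr 1
    ext ζ
    rw [smul_smul, ← AddChar.map_add_eq_mul, inner_sub_right]
    congr 2
    ring

theorem HasSpectrum.pow_freqSquare {κ : ℝ} {f : Plane → ℂ} (h : HasSpectrum (freqSquare κ) f)
    (k : ℕ) : HasSpectrum (freqSquare ((k + 1 : ℕ) * κ)) (f ^ (k + 1)) := by
  induction k with
  | zero => simpa using h
  | succ k ih =>
    rw [pow_succ]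
    refine (ih.mul h).mono ?_
    rintro _ ⟨ζ, hζ, ζ', hζ', rfl⟩ i
    have h1 := hζ i
    have h2 := hζ' i
    push_cast at h1 ⊢
    calc |ζ i + ζ' i| ≤ |ζ i| + |ζ' i| := abs_add_le _ _
      _ ≤ _ := by linarith

open scoped Pointwise in
/-- Multiplying the extension of `g` from `J` by a function with spectrum `Ω` gives a function whose
spectrum lies in the `Ω`-neighbourhood of the arc over `J`. -/
theorem HasSpectrum.extension_mul {Ω : Set Plane} {f : Plane → ℂ} (h : HasSpectrum Ω f)
    {J : Set ℝ} {g : ℝ → ℂ} (hg : IntegrableOn g J) :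
    HasSpectrum ((fun ξ : ℝ => (!₂[ξ, ξ ^ 2] : Plane)) '' J + Ω)
      fun x => extension J g x * f x := by
  obtain ⟨F, h1, ⟨C, h2⟩, h3, rfl⟩ := h
  set γ : ℝ → Plane := fun ξ => !₂[ξ, ξ ^ 2] with hγ
  have hγc : Continuous γ := by
    rw [hγ]
    fun_prop
  have hmp : MeasurePreserving (fun p : ℝ × Plane => (p.1, p.2 + γ p.1))
      ((volume.restrict J).prod volume) ((volume.restrict J).prod volume) :=
    (MeasurePreserving.id _).skew_product (g := fun ξ ζ => ζ + γ ξ)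
      (by fun_prop) (ae_of_all _ fun ξ => (measurePreserving_add_right volume (γ ξ)).map_eq)
  have hprod : Integrable (fun p : ℝ × Plane => g p.1 * F (p.2 + γ p.1))
      ((volume.restrict J).prod volume) :=
    hmp.integrable_comp_of_integrable (Integrable.mul_prod hg h1)
  have hγx : ∀ (ξ : ℝ) (x : Plane), inner ℝ (γ ξ) x = ξ * x 0 + ξ ^ 2 * x 1 := by
    intro ξ x
    rw [inner_plane]
    simp [hγ]
  refine ⟨fun ζ => ∫ ξ in J, g ξ * F (ζ + γ ξ), hprod.integral_prod_right,
    ⟨(∫ ξ in J, ‖g ξ‖) * C, fun ζ => ?_⟩, fun ζ hζ => ?_, ?_⟩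
  · rw [← integral_mul_const]
    refine norm_integral_le_of_norm_le (hg.norm.mul_const C) (ae_of_all _ fun t => ?_)
    rw [norm_mul]
    exact mul_le_mul_of_nonneg_left (h2 _) (norm_nonneg _)
  · obtain ⟨ξ, hξ, hne⟩ : ∃ ξ ∈ J, g ξ * F (ζ + γ ξ) ≠ 0 := by
      by_contra! h0
      exact hζ (setIntegral_eq_zero_of_forall_eq_zero h0)
    refine ⟨γ ξ, ⟨ξ, hξ, rfl⟩, -(ζ + γ ξ), h3 _ (right_ne_zero_of_mul hne), ?_⟩
    change γ ξ + -(ζ + γ ξ) = -ζ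
    abel
  · ext x
    have he : ∀ ξ : ℝ, e (ξ * x 0 + ξ ^ 2 * x 1) = ((𝐞 (inner ℝ (γ ξ) x) : Circle) : ℂ) := by
      intro ξ
      rw [hγx, e, Real.fourierChar_apply]
      push_cast
      ring_nf
    symm
    calc 𝓕 (fun ζ => ∫ ξ in J, g ξ * F (ζ + γ ξ)) x
        = ∫ ζ, ∫ ξ in J, 𝐞 (-inner ℝ ζ x) • (g ξ * F (ζ + γ ξ)) := by
          rw [Real.fourier_eq]
          congr 1
          ext ζ
          simp_rw [Circle.smul_def, smul_eq_mul]
          exact (integral_const_mul _ _).symm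
      _ = ∫ ξ in J, ∫ ζ, 𝐞 (-inner ℝ ζ x) • (g ξ * F (ζ + γ ξ)) := by
          refine (integral_integral_swap ?_).symm
          refine hprod.norm.mono' ?_ (ae_of_all _ fun p => (Circle.norm_smul _ _).le)
          have hc : Continuous fun p : ℝ × Plane => ((𝐞 (-inner ℝ p.2 x) : Circle) : ℂ) := by
            fun_prop
          exact hc.aestronglyMeasurable.smul hprod.aestronglyMeasurable
      _ = ∫ ξ in J, (g ξ * e (ξ * x 0 + ξ ^ 2 * x 1)) * 𝓕 F x := by
          congr 1
          ext ξ
          rw [Real.fourier_eq, ← integral_add_right_eq_self (fun ζ => 𝐞 (-inner ℝ ζ x) • F ζ) (γ ξ),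
            ← integral_const_mul]
          congr 1
          ext ζ
          have hs : (𝐞 (-inner ℝ ζ x) : Circle)
              = 𝐞 (inner ℝ (γ ξ) x) * 𝐞 (-inner ℝ (ζ + γ ξ) x) := by
            rw [← AddChar.map_add_eq_mul, inner_add_left]
            congr 1
            ring
          rw [he, hs, Circle.smul_def, Circle.smul_def, Circle.coe_mul, smul_eq_mul, smul_eq_mul]
          ring
      _ = extension J g x * 𝓕 F x := integral_mul_const _ _

theorem abs_sinc_mul_abs_le_one (t : ℝ) : |Real.sinc t| * |t| ≤ 1 := by
  rcases eq_or_ne t 0 with rfl | h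
  · simp
  rw [Real.sinc_of_ne_zero h, abs_div, div_mul_cancel₀ _ (abs_ne_zero.2 h)]
  exact Real.abs_sin_le_one t

theorem half_le_sinc {t : ℝ} (ht : |t| ≤ 1) : 1 / 2 ≤ Real.sinc t := by
  wlog h : 0 ≤ t generalizing t
  · rw [← Real.sinc_neg]
    exact this (by rwa [abs_neg]) (by linarith)
  rcases h.eq_or_lt with rfl | h
  · norm_num
  have h1 : t ≤ 1 := (le_abs_self t).trans ht
  have h2 := Real.sin_gt_sub_cube h
  rw [Real.sinc_of_ne_zero h.ne', le_div_iff₀ h]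
  nlinarith [mul_pos h h]

theorem norm_le_abs_add_abs (x : Plane) : ‖x‖ ≤ |x 0| + |x 1| := by
  have h : ‖x‖ ^ 2 = x 0 ^ 2 + x 1 ^ 2 := by
    rw [EuclideanSpace.real_norm_sq_eq, Fin.sum_univ_two]
  refine abs_le_of_sq_le_sq' ?_ (by positivity) |>.2
  rw [h]
  nlinarith [sq_abs (x 0), sq_abs (x 1), mul_nonneg (abs_nonneg (x 0)) (abs_nonneg (x 1))]

theorem norm_sincProd (κ : ℝ) (x : Plane) : ‖sincProd κ x‖
    = |Real.sinc (2 * Real.pi * κ * x 0)| * |Real.sinc (2 * Real.pi * κ * x 1)| := by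
  rw [sincProd, Complex.norm_real, Real.norm_eq_abs, abs_mul]

/-- The window is bounded below on the square of side length `R`. -/
theorem quarter_le_norm_sincProd {R : ℝ} (hR : 0 < R) {x : Plane} (hx : ∀ i, |x i| ≤ R / 2) :
    1 / 4 ≤ ‖sincProd (1 / (17 * R)) x‖ := by
  have h : ∀ i, 1 / 2 ≤ Real.sinc (2 * Real.pi * (1 / (17 * R)) * x i) := by
    intro i
    refine half_le_sinc ?_
    rw [abs_mul, abs_of_pos (by positivity)]
    calc 2 * Real.pi * (1 / (17 * R)) * |x i| ≤ 2 * Real.pi * (1 / (17 * R)) * (R / 2) := by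
          gcongr; exact hx i
      _ = Real.pi / 17 := by field_simp
      _ ≤ 1 := by linarith [Real.pi_le_four]
  rw [norm_sincProd]
  nlinarith [h 0, h 1, le_abs_self (Real.sinc (2 * Real.pi * (1 / (17 * R)) * x 0)),
    le_abs_self (Real.sinc (2 * Real.pi * (1 / (17 * R)) * x 1))]

/-- The window decays like the inverse of the distance, relative to `R`. -/
theorem norm_sincProd_mul_le {R : ℝ} (hR : 0 < R) (x : Plane) :
    ‖sincProd (1 / (17 * R)) x‖ * (1 + ‖x‖ / R) ≤ 7 := by
  have hb : ∀ i, |x i| / R ≤ 3 * |2 * Real.pi * (1 / (17 * R)) * x i| := by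
    intro i
    have h17 : 17 ≤ 3 * (2 * Real.pi) := by linarith [Real.pi_gt_three]
    rw [abs_mul, abs_of_pos (by positivity : 0 < 2 * Real.pi * (1 / (17 * R)))]
    rw [show 3 * (2 * Real.pi * (1 / (17 * R)) * |x i|)
      = (3 * (2 * Real.pi)) / 17 * (|x i| / R) by field_simp]
    refine le_mul_of_one_le_left (by positivity) ?_
    linarith
  have hnorm : ‖x‖ / R ≤ |x 0| / R + |x 1| / R := by
    rw [← add_div]; gcongr; exact norm_le_abs_add_abs x
  rw [norm_sincProd]
  set s := 2 * Real.pi * (1 / (17 * R)) * x 0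
  set t := 2 * Real.pi * (1 / (17 * R)) * x 1
  have hs := Real.abs_sinc_le_one s
  have ht := Real.abs_sinc_le_one t
  have hs' := abs_sinc_mul_abs_le_one s
  have ht' := abs_sinc_mul_abs_le_one t
  have hs0 := abs_nonneg (Real.sinc s)
  have ht0 := abs_nonneg (Real.sinc t)
  have p0 : |Real.sinc s| * |Real.sinc t| ≤ 1 := mul_le_one₀ hs ht0 ht
  have p1 : |Real.sinc t| * (|Real.sinc s| * |s|) ≤ 1 := mul_le_one₀ ht (by positivity) hs'
  have p2 : |Real.sinc s| * (|Real.sinc t| * |t|) ≤ 1 := mul_le_one₀ hs (by positivity) ht'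
  calc |Real.sinc s| * |Real.sinc t| * (1 + ‖x‖ / R)
      ≤ |Real.sinc s| * |Real.sinc t| * (1 + (3 * |s| + 3 * |t|)) := by
        gcongr
        linarith [hb 0, hb 1]
    _ ≤ 7 := by linarith

/-! ### From functions on the plane to a square -/

theorem extension_Icc_eq_sum {N : ℕ} (hN : 0 < N) {g : ℝ → ℂ} (hg : IntegrableOn g (Icc 0 1))
    (x : Plane) :
    extension (Icc 0 1) g x = ∑ k ∈ Finset.range N, extension (cap (1 / N) k) g x := by
  have hN' : (0 : ℝ) < N := by exact_mod_cast hN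
  set G : ℝ → ℂ := fun ξ => g ξ * e (ξ * x 0 + ξ ^ 2 * x 1) with hG
  have hGint : IntegrableOn G (Icc 0 1) := by
    refine hg.norm.mono' ?_ (ae_of_all _ fun ξ => ?_)
    · refine hg.aestronglyMeasurable.mul (Continuous.aestronglyMeasurable ?_)
      unfold e
      fun_prop
    · rw [hG]
      simp only [norm_mul]
      rw [e, show (2 * (Real.pi : ℂ) * Complex.I * ((ξ * x 0 + ξ ^ 2 * x 1 : ℝ) : ℂ))
        = ((2 * Real.pi * (ξ * x 0 + ξ ^ 2 * x 1) : ℝ) : ℂ) * Complex.I by push_cast; ring,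
        Complex.norm_exp_ofReal_mul_I, mul_one]
  have hend : ∀ k : ℕ, k ≤ N → (k : ℝ) * (1 / N) ∈ Icc (0 : ℝ) 1 := by
    intro k hk
    have hk : (k : ℝ) ≤ N := by exact_mod_cast hk
    refine ⟨by positivity, ?_⟩
    rw [mul_one_div, div_le_one hN']
    exact hk
  have h := intervalIntegral.sum_integral_adjacent_intervals (μ := volume) (f := G) (n := N)
    (a := fun k => (k : ℝ) * (1 / N)) ?_
  · simp only [Nat.cast_zero, mul_one_div, div_self hN'.ne', zero_div] at h
    rw [intervalIntegral.integral_of_le zero_le_one, ← integral_Icc_eq_integral_Ioc] at h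
    rw [extension, ← h]
    refine Finset.sum_congr rfl fun k _ => ?_
    rw [intervalIntegral.integral_of_le (by gcongr; simp), ← integral_Icc_eq_integral_Ioc,
      extension, cap]
    simp only [mul_one_div, Nat.cast_add, Nat.cast_one]
    rfl
  · intro k hk
    refine (hGint.mono_set ?_).intervalIntegrable
    exact uIcc_subset_Icc (hend k hk.le) (hend (k + 1) hk)

theorem measurableSet_square (c : Plane) (R : ℝ) : MeasurableSet (square c R) := by
  have : square c R = ⋂ i, {x : Plane | |x i - c i| ≤ R / 2} := by
    ext x; simp [square]
  rw [this]
  exact MeasurableSet.iInter fun i =>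
    (isClosed_le (by fun_prop) continuous_const).measurableSet

theorem normL6On_eq (B : Set Plane) (f : Plane → ℂ) :
    normL6On B f = (∫⁻ x in B, ‖f x‖ₑ ^ 6) ^ (1 / 6 : ℝ) := by
  rw [normL6On, eLpNorm_eq_lintegral_rpow_enorm_toReal (by norm_num) (by norm_num)]
  norm_num

theorem normL6Weighted_sq_eq {w : Plane → ℝ} (hw : Measurable w) (f : Plane → ℂ) :
    normL6Weighted w f ^ 2 = (∫⁻ x, ENNReal.ofReal (w x) * ‖f x‖ₑ ^ 6) ^ (1 / 3 : ℝ) := by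
  rw [normL6Weighted, eLpNorm_eq_lintegral_rpow_enorm_toReal (by norm_num) (by norm_num),
    lintegral_withDensity_eq_lintegral_mul_non_measurable _ hw.ennreal_ofReal
      (ae_of_all _ fun _ => ENNReal.ofReal_lt_top), ← ENNReal.rpow_mul_natCast]
  norm_num

/-- A decoupling bound for functions with spectrum near the parabola gives the local inequality for
the extension operator: multiply `E_J g` by the seventeenth power of the window, so that its sixth
power decays like `|x| ^ (-102)`. Arcs beyond `[0, 1]` carry the zero function. -/
theorem isAdmissible_of_decouplingBound {N n m : ℕ} (hN : 0 < N) (hNn : N ≤ n ^ m) {E C : ℝ≥0∞}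
    (h : DecouplingBound n m E) (hC : 4 ^ 102 * 7 ^ 100 * E ≤ C ^ 6) :
    IsAdmissible (1 / N) C := by
  intro g hg c
  have hN' : (0 : ℝ) < N := by exact_mod_cast hN
  have hN1 : (1 : ℝ) ≤ N := by exact_mod_cast hN
  have hfloor : ⌊((1 : ℝ) / N)⁻¹⌋₊ = N := by simp
  rw [hfloor]
  set δ : ℝ := 1 / N with hδdef
  have hδ : 0 < δ := by positivity
  have hδ1 : δ ≤ 1 := by rw [hδdef, div_le_one hN']; exact hN1
  have hδN : N * δ = 1 := by rw [hδdef]; field_simp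
  set R : ℝ := (δ ^ 2)⁻¹ with hR
  have hRpos : 0 < R := by positivity
  set φ : Plane → ℂ := (fun x => sincProd (1 / (17 * R)) (x - c)) ^ 17 with hφdef
  have hφ : HasSpectrum (freqSquare (δ ^ 2)) φ := by
    have h17 := ((hasSpectrum_sincProd (κ := 1 / (17 * R)) (by positivity)).translate
      c).pow_freqSquare 16
    have e1 : ((16 + 1 : ℕ) : ℝ) * (1 / (17 * R)) = δ ^ 2 := by
      rw [hR]; push_cast; field_simp
    rwa [e1] at h17
  -- Zero padding makes the number of arcs a power of `n`.
  set f : ℕ → Plane → ℂ := fun k => if k < N then fun x => extension (cap δ k) g x * φ x else 0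
    with hfdef
  have hfk : ∀ k ∈ Finset.range N, f k = fun x => extension (cap δ k) g x * φ x := fun k hk => by
    simp [hfdef, Finset.mem_range.1 hk]
  have hfz : ∀ k ∈ Finset.range (n ^ m), k ∉ Finset.range N → f k = 0 := fun k _ hk => by
    simp only [Finset.mem_range] at hk
    simp [hfdef, hk]
  have hsub : Finset.range N ⊆ Finset.range (n ^ m) := Finset.range_mono hNn
  have hfam : IsCapFamily δ 0 (n ^ m) f := by
    intro k _
    by_cases hk : k < N
    swap
    · rw [hfdef]
      simp only [if_neg hk]
      exact hasSpectrum_zero _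
    rw [hfk k (Finset.mem_range.2 hk)]
    have hk1 : (k : ℝ) + 1 ≤ N := by exact_mod_cast hk
    have hkδ : ((k : ℝ) + 1) * δ ≤ 1 := by
      calc ((k : ℝ) + 1) * δ ≤ N * δ := by gcongr
        _ = 1 := hδN
    refine (hφ.extension_mul (hg.mono_set fun ξ hξ => ?_)).mono ?_
    · exact ⟨le_trans (by positivity) hξ.1, hξ.2.trans hkδ⟩
    · rintro _ ⟨_, ⟨ξ, ⟨hξ1, hξ2⟩, rfl⟩, ω, hω, rfl⟩
      have h0 := abs_le.1 (hω 0)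
      have h1 := abs_le.1 (hω 1)
      have hξ0 : 0 ≤ ξ := le_trans (by positivity) hξ1
      have hξle : ξ ≤ 1 := hξ2.trans hkδ
      have hδδ : δ ^ 2 ≤ δ := by nlinarith
      have hω2 : ω 0 ^ 2 ≤ δ ^ 2 := by
        have : ω 0 ^ 2 ≤ (δ ^ 2) ^ 2 := sq_le_sq' h0.1 h0.2
        nlinarith [pow_le_one₀ hδ.le hδ1 (n := 2), sq_nonneg δ]
      have a1 : ξ * ω 0 ≤ δ ^ 2 := by nlinarith
      have a2 : -δ ^ 2 ≤ ξ * ω 0 := by nlinarith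
      refine ⟨?_, ?_, abs_le.2 ⟨?_, ?_⟩⟩
      · simp; linarith
      · simp; linarith
      · simp; nlinarith
      · simp; nlinarith [sq_nonneg (ω 0)]
  have hsum : ∀ x, ∑ k ∈ Finset.range (n ^ m), f k x = extension (Icc 0 1) g x * φ x := by
    intro x
    rw [← Finset.sum_subset hsub fun k hk hk' => by rw [hfz k hk hk']; rfl,
      extension_Icc_eq_sum hN hg, Finset.sum_mul]
    exact Finset.sum_congr rfl fun k hk => by rw [hfk k hk]
  have hw : Measurable (weight c R) := by
    unfold weight
    fun_prop
  set W : ℝ≥0∞ := ∑ k ∈ Finset.range N, normL6Weighted (weight c R) (extension (cap δ k) g) ^ 2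
    with hW
  have hφw : ∀ x, ‖φ x‖ₑ ^ 6 ≤ 7 ^ 100 * ENNReal.ofReal (weight c R x) := by
    intro x
    set u := ‖sincProd (1 / (17 * R)) (x - c)‖ with hu
    have hu1 : u ≤ 1 := by
      rw [hu, norm_sincProd]
      exact mul_le_one₀ (Real.abs_sinc_le_one _) (abs_nonneg _) (Real.abs_sinc_le_one _)
    have hu7 := norm_sincProd_mul_le hRpos (x - c)
    rw [← hu] at hu7
    have hreal : ‖φ x‖ ^ 6 ≤ 7 ^ 100 * weight c R x := by
      rw [weight, ← div_eq_mul_inv, le_div_iff₀ (by positivity)]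
      calc ‖φ x‖ ^ 6 * (1 + ‖x - c‖ / R) ^ 100 = u ^ 102 * (1 + ‖x - c‖ / R) ^ 100 := by
            rw [hφdef, Pi.pow_apply, norm_pow, ← pow_mul]
        _ ≤ u ^ 100 * (1 + ‖x - c‖ / R) ^ 100 := by
            gcongr ?_ * _
            exact pow_le_pow_of_le_one (norm_nonneg _) hu1 (by norm_num)
        _ = (u * (1 + ‖x - c‖ / R)) ^ 100 := (mul_pow _ _ _).symm
        _ ≤ 7 ^ 100 := by gcongr
    have := ENNReal.ofReal_le_ofReal hreal
    rw [ENNReal.ofReal_mul (by positivity), ENNReal.ofReal_pow (norm_nonneg _), ofReal_norm,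
      ENNReal.ofReal_pow (by norm_num)] at this
    simpa using this
  have hcap : capSum (n ^ m) f ≤ (7 ^ 100) ^ (1 / 3 : ℝ) * W := by
    rw [capSum, ← Finset.sum_subset hsub fun k hk hk' => by rw [hfz k hk hk']; simp [sixNormSq],
      hW, Finset.mul_sum]
    gcongr with k hk
    rw [hfk k hk, normL6Weighted_sq_eq hw, sixNormSq,
      ← ENNReal.mul_rpow_of_nonneg _ _ (by norm_num), ← lintegral_const_mul' _ _ (by finiteness)]
    gcongr with x
    rw [enorm_mul, mul_pow, mul_comm, ← mul_assoc]
    gcongr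
    exact hφw x
  have hφB : ∀ x ∈ square c R, 1 ≤ 4 ^ 102 * ‖φ x‖ₑ ^ 6 := by
    intro x hx
    have hq := quarter_le_norm_sincProd hRpos (x := x - c) hx
    have hreal : 1 ≤ 4 ^ 102 * ‖φ x‖ ^ 6 := by
      rw [hφdef, Pi.pow_apply, norm_pow, ← pow_mul, ← mul_pow]
      exact one_le_pow₀ (by linarith)
    have := ENNReal.ofReal_le_ofReal hreal
    rw [ENNReal.ofReal_mul (by positivity), ENNReal.ofReal_pow (norm_nonneg _), ofReal_norm,
      ENNReal.ofReal_pow (by norm_num)] at this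
    simpa using this
  have main : ∫⁻ x in square c R, ‖extension (Icc 0 1) g x‖ₑ ^ 6 ≤ C ^ 6 * W ^ 3 := by
    calc ∫⁻ x in square c R, ‖extension (Icc 0 1) g x‖ₑ ^ 6
        ≤ ∫⁻ x in square c R, 4 ^ 102 * ‖∑ k ∈ Finset.range (n ^ m), f k x‖ₑ ^ 6 := by
          refine setLIntegral_mono' (measurableSet_square c R) fun x hx => ?_
          rw [hsum, enorm_mul, mul_pow, mul_left_comm]
          exact le_mul_of_one_le_right' (hφB x hx)
      _ ≤ ∫⁻ x, 4 ^ 102 * ‖∑ k ∈ Finset.range (n ^ m), f k x‖ₑ ^ 6 := setLIntegral_le_lintegral _ _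
      _ = 4 ^ 102 * ∫⁻ x, ‖∑ k ∈ Finset.range (n ^ m), f k x‖ₑ ^ 6 :=
          lintegral_const_mul' _ _ (by finiteness)
      _ ≤ 4 ^ 102 * (E * ((7 ^ 100) ^ (1 / 3 : ℝ) * W) ^ 3) := by
          gcongr
          exact (h δ hδ 0 f hfam).trans (by gcongr)
      _ = 4 ^ 102 * 7 ^ 100 * E * W ^ 3 := by
          have : ((7 ^ 100 : ℝ≥0∞) ^ (1 / 3 : ℝ)) ^ 3 = 7 ^ 100 := by
            rw [← ENNReal.rpow_mul_natCast]; norm_num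
          rw [mul_pow, this]
          ring
      _ ≤ C ^ 6 * W ^ 3 := by gcongr
  calc normL6On (square c R) (extension (Icc 0 1) g)
      ≤ (C ^ 6 * W ^ 3) ^ (1 / 6 : ℝ) := by
        rw [normL6On_eq]
        gcongr
    _ = C * W ^ (1 / 2 : ℝ) := by
        rw [ENNReal.mul_rpow_of_nonneg _ _ (by norm_num), ← ENNReal.rpow_natCast_mul,
          ← ENNReal.rpow_natCast_mul]
        norm_num

/-! ### Choice of parameters -/

/-- With `ℓ = log log N`, the parameters are `j ≈ ℓ / 2` steps, `m ≈ (log N) ^ (3 / 4)` scales and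
`n ≈ N ^ (1 / m)` arcs per scale. Then `n ^ (6 * 2 ^ (j + 1))` is negligible, and
`r ^ (2 * m) = n ^ (22 * m / (j + 1))` is at most `exp (88 * log N / ℓ)`. -/
theorem exists_parameters {N : ℕ} {L ℓ : ℝ} (hN : (N : ℝ) = Real.exp L) (hL : L = Real.exp ℓ)
    (hℓ : 200 ≤ ℓ) :
    ∃ (n m j : ℕ) (r : ℝ), 2 ≤ n ∧ N ≤ n ^ m ∧ 2 * 4 ^ 6 ≤ r ^ 2 ∧ 1 ≤ r ∧
      2 * 36 ^ 2 * (n : ℝ) ^ 10 ≤ r ^ (j + 1) ∧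
      4 ^ 102 * 7 ^ 100 * ((n : ℝ) ^ (6 * 2 ^ (j + 1)) * r ^ (2 * m))
        ≤ Real.exp (30 * (L / ℓ)) ^ 6 := by
  set m : ℕ := ⌈Real.exp (3 * ℓ / 4)⌉₊ with hm
  set j : ℕ := ⌊ℓ / 2⌋₊ with hj
  set n : ℕ := ⌈Real.exp (L / m)⌉₊ with hn
  have hm1 : Real.exp (3 * ℓ / 4) ≤ m := Nat.le_ceil _
  have hm2 : (m : ℝ) ≤ 2 * Real.exp (3 * ℓ / 4) := by
    have h1 := (Nat.ceil_lt_add_one (Real.exp_pos (3 * ℓ / 4)).le).le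
    have h2 := Real.one_le_exp (x := 3 * ℓ / 4) (by linarith)
    linarith
  have hm0 : (0 : ℝ) < m := (Real.exp_pos _).trans_le hm1
  have hj1 : (j : ℝ) ≤ ℓ / 2 := Nat.floor_le (by linarith)
  have hj2 : ℓ / 2 < j + 1 := Nat.lt_floor_add_one _
  have hLpos : 0 < L := hL ▸ Real.exp_pos _
  have hq : 2 * ℓ ≤ Real.exp (ℓ / 4) := by
    have := Real.quadratic_le_exp_of_nonneg (x := ℓ / 4) (by linarith)
    nlinarith
  have hLm : ℓ ≤ L / m := by
    rw [le_div_iff₀ hm0]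
    have : L = Real.exp (ℓ / 4) * Real.exp (3 * ℓ / 4) := by
      rw [hL, ← Real.exp_add]; congr 1; ring
    rw [this]
    nlinarith [Real.exp_pos (3 * ℓ / 4)]
  have hn1 : Real.exp (L / m) ≤ n := Nat.le_ceil _
  have hexp12 : (4096 : ℝ) ≤ Real.exp 12 := by
    have h2 : (2 : ℝ) ≤ Real.exp 1 := by linarith [Real.add_one_le_exp (1 : ℝ)]
    calc (4096 : ℝ) = 2 ^ 12 := by norm_num
      _ ≤ Real.exp 1 ^ 12 := by gcongr
      _ = Real.exp 12 := by rw [← Real.exp_nat_mul]; norm_num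
  have hn4096 : (4096 : ℝ) ≤ n :=
    hexp12.trans ((Real.exp_le_exp.2 (by linarith)).trans hn1)
  have hn0 : (0 : ℝ) < n := by linarith
  have hlog1 : L / m ≤ Real.log n := (Real.le_log_iff_exp_le hn0).2 hn1
  have hlog2 : Real.log n ≤ 2 * (L / m) := by
    rw [Real.log_le_iff_le_exp hn0, two_mul, Real.exp_add]
    have h1 := (Nat.ceil_lt_add_one (Real.exp_pos (L / m)).le).le
    have h2 : 2 ≤ Real.exp (L / m) := by linarith [Real.add_one_le_exp (L / m)]
    rw [← hn] at h1
    nlinarith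
  set lam := Real.log n with hlam
  have hnexp : (n : ℝ) = Real.exp lam := (Real.exp_log hn0).symm
  have hj0 : (0 : ℝ) < j + 1 := by positivity
  set r := Real.exp (11 * lam / (j + 1)) with hr
  have hlampos : 0 < lam := by linarith
  refine ⟨n, m, j, r, ?_, ?_, ?_, ?_, ?_, ?_⟩
  · have : (2 : ℝ) ≤ n := by linarith
    exact_mod_cast this
  · have : (N : ℝ) ≤ (n : ℝ) ^ m := by
      calc (N : ℝ) = Real.exp (L / m) ^ m := by
            rw [hN, ← Real.exp_nat_mul, mul_div_cancel₀ _ hm0.ne']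
        _ ≤ (n : ℝ) ^ m := by gcongr
    exact_mod_cast this
  · rw [hr, ← Real.exp_nat_mul]
    have h1 : 1 ≤ lam / (j + 1) := by rw [le_div_iff₀ hj0]; linarith
    calc (2 * 4 ^ 6 : ℝ) ≤ 4096 * 11 := by norm_num
      _ ≤ Real.exp 12 * Real.exp 10 := by
        gcongr
        linarith [Real.add_one_le_exp (10 : ℝ)]
      _ = Real.exp 22 := by rw [← Real.exp_add]; norm_num
      _ ≤ _ := by
        apply Real.exp_le_exp.2
        have : ((2 : ℕ) : ℝ) * (11 * lam / (j + 1)) = 22 * (lam / (j + 1)) := by push_cast; ring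
        linarith
  · exact Real.one_le_exp (by positivity)
  · rw [hr, ← Real.exp_nat_mul]
    push_cast
    rw [mul_div_cancel₀ _ hj0.ne', show (11 : ℝ) * lam = (11 : ℕ) * lam by norm_num,
      Real.exp_nat_mul, ← hnexp, pow_succ' (n : ℝ) 10]
    gcongr
    linarith
  · have c1 : (4 : ℝ) ^ 102 * 7 ^ 100 ≤ Real.exp 504 := by
      have h2 : (2 : ℝ) ≤ Real.exp 1 := by linarith [Real.add_one_le_exp (1 : ℝ)]
      calc (4 : ℝ) ^ 102 * 7 ^ 100 ≤ 4 ^ 102 * 8 ^ 100 := by gcongr; norm_num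
        _ = 2 ^ 504 := by
          rw [show (4 : ℝ) = 2 ^ 2 by norm_num, show (8 : ℝ) = 2 ^ 3 by norm_num, ← pow_mul,
            ← pow_mul, ← pow_add]
        _ ≤ Real.exp 1 ^ 504 := by gcongr
        _ = Real.exp 504 := by rw [← Real.exp_nat_mul]; norm_num
    have c2 : (n : ℝ) ^ (6 * 2 ^ (j + 1)) * r ^ (2 * m)
        = Real.exp (12 * 2 ^ j * lam + 22 * m * lam / (j + 1)) := by
      rw [hnexp, hr, ← Real.exp_nat_mul, ← Real.exp_nat_mul, ← Real.exp_add]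
      congr 1
      push_cast
      ring
    have hLℓ : 100 ≤ L / ℓ := by
      rw [le_div_iff₀ (by linarith), hL]
      have := Real.quadratic_le_exp_of_nonneg (x := ℓ) (by linarith)
      nlinarith
    have d1 : 22 * m * lam / (j + 1) ≤ 88 * (L / ℓ) := by
      calc 22 * m * lam / (j + 1) ≤ 22 * m * (2 * (L / m)) / (ℓ / 2) := by
            gcongr
        _ = 88 * (L / ℓ) := by
            have : ℓ ≠ 0 := by linarith
            field_simp
            norm_num
    have d2 : (2 : ℝ) ^ j * lam ≤ L / ℓ := by
      have h2 : (2 : ℝ) ^ j ≤ Real.exp (ℓ / 2) := by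
        calc (2 : ℝ) ^ j ≤ Real.exp 1 ^ j := by
              gcongr
              linarith [Real.add_one_le_exp (1 : ℝ)]
          _ = Real.exp j := by rw [← Real.exp_nat_mul, mul_one]
          _ ≤ Real.exp (ℓ / 2) := Real.exp_le_exp.2 hj1
      calc (2 : ℝ) ^ j * lam ≤ Real.exp (ℓ / 2) * (2 * (L / Real.exp (3 * ℓ / 4))) := by
            gcongr
            exact hlog2.trans (by gcongr)
        _ = 2 * L / Real.exp (ℓ / 4) := by
            rw [show 3 * ℓ / 4 = ℓ / 2 + ℓ / 4 by ring, Real.exp_add]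
            field_simp
        _ ≤ 2 * L / (2 * ℓ) := by gcongr
        _ = L / ℓ := by rw [mul_div_mul_left _ _ two_ne_zero]
    calc (4 : ℝ) ^ 102 * 7 ^ 100 * ((n : ℝ) ^ (6 * 2 ^ (j + 1)) * r ^ (2 * m))
        ≤ Real.exp 504 * Real.exp (12 * 2 ^ j * lam + 22 * m * lam / (j + 1)) := by
          rw [c2]
          gcongr
      _ ≤ Real.exp (30 * (L / ℓ)) ^ 6 := by
          rw [← Real.exp_add, ← Real.exp_nat_mul]
          apply Real.exp_le_exp.2
          push_cast
          linarith

end ParabolaDecoupling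

end

theorem theorem1p1 (δ : ℝ) (hδN : ∃ N : ℕ, 0 < N ∧ δ = 1 / (N : ℝ))
    (hδ : δ < Real.exp (-(200 : ℝ) ^ 200)) :
    ParabolaDecoupling.decouplingConstant δ ≤
      ENNReal.ofReal (Real.exp (30 * (Real.log (1 / δ) / Real.log (Real.log (1 / δ))))) := by
  obtain ⟨N, hN, rfl⟩ := hδN
  have hN' : (0 : ℝ) < N := by exact_mod_cast hN
  rw [one_div_one_div]
  set L := Real.log N with hL
  have hNL : (N : ℝ) = Real.exp L := (Real.exp_log hN').symm
  have hLbig : (200 : ℝ) ^ 200 < L := by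
    rw [hNL, one_div, ← Real.exp_neg, Real.exp_lt_exp] at hδ
    linarith
  have hLpos : 0 < L := lt_trans (by positivity) hLbig
  have hℓ : 200 ≤ Real.log L := by
    rw [Real.le_log_iff_exp_le hLpos]
    refine le_trans ?_ hLbig.le
    calc Real.exp 200 = Real.exp 1 ^ 200 := by rw [← Real.exp_nat_mul]; norm_num
      _ ≤ 200 ^ 200 := by
        gcongr
        linarith [Real.exp_one_lt_d9]
  obtain ⟨n, m, j, r, hn, hNn, hr, hr1, hrj, hfin⟩ :=
    ParabolaDecoupling.exists_parameters hNL (Real.exp_log hLpos).symm hℓ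
  refine sInf_le (ParabolaDecoupling.isAdmissible_of_decouplingBound hN hNn
    (ParabolaDecoupling.decouplingBound_of_iterate hn hr hr1 hrj m) ?_)
  rw [← ENNReal.ofReal_pow (Real.exp_pos _).le]
  refine le_trans (le_of_eq ?_) (ENNReal.ofReal_le_ofReal hfin)
  have h47 : ENNReal.ofReal ((4 : ℝ) ^ 102 * 7 ^ 100) = 4 ^ 102 * 7 ^ 100 := by
    rw [ENNReal.ofReal_mul (by positivity), ENNReal.ofReal_pow (by positivity),
      ENNReal.ofReal_pow (by positivity), ENNReal.ofReal_ofNat, ENNReal.ofReal_ofNat]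
  rw [ENNReal.ofReal_mul (p := (4 : ℝ) ^ 102 * 7 ^ 100) (by positivity), h47]
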